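/- Let $p\neq\ell$ be prime numbers and let $F$ be a non-Archimedean local field of residual characteristic $p$, with separable algebraic closure $\overline F$, Weil group $\mathcal W_F$ and wild inertia subgroup $\mathcal P_F\subset\mathcal W_F$. All representations are over $\overline{\mathbb Q}_\ell$ unless stated otherwise. If $\sigma$ is a smooth finite-dimensional representation of the Weil group $\mathcal W_K$ of a finite extension $K/F$ with $\sigma(\mathcal W_K)$ finite (for $\sigma$ irreducible, this holds as soon as the character $\det\sigma$ has finite order), let $[\sigma]_\ell^{\mathrm{ss}}$ be the isomorphism class of the semisimplification of the representation of $\mathcal W_K$ on $L/\mathfrak m L$. Here $\overline{\mathbb Z}_\ell$ is the integral closure of $\mathbb Z_\ell$ in $\overline{\mathbb Q}_\ell$, $\mathfrak m$ is its maximal ideal, and $L$ is any $\mathcal W_K$-stable $\overline{\mathbb Z}_\ell$-lattice in $\sigma$; this class does not depend on $L$. Write $\sigma_1\equiv\sigma_2 \pmod\ell$ if $[\sigma_1]_\ell^{\mathrm{ss}}=[\sigma_2]_\ell^{\mathrm{ss}}$. Let $\alpha$ be an irreducible smooth representation of $\mathcal P_F$, and let $E=Z_F(\alpha)$, that is, $E/F$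 is the finite tamely ramified extension in $\overline F$ such that $\mathcal W_E$ is the isotropy group in $\mathcal W_F$ of the isomorphism class of $\alpha$ under conjugation. Let $\rho$ be a smooth representation of $\mathcal W_E$ such that $\rho|_{\mathcal P_F}\cong\alpha$ and $\det\rho$ has finite order. Let $m\ge1$ be an integer, and let $\tau_1,\tau_2$ be irreducible smooth representations of $\mathcal W_E$ that contain the trivial representation of the wild inertia group $\mathcal P_E$ with multiplicity $m$ (equivalently, that are $m$-dimensional and tamely ramified), with $\det\tau_1$ and $\det\tau_2$ of finite order. Then $$\operatorname{Ind}_{\mathcal W_E}^{\mathcal W_F}(\rho\otimes\tau_1)\equiv \operatorname{Ind}_{\mathcal W_E}^{\mathcal W_F}(\rho\otimes\tau_2)\pmod \ell\quad\Longleftrightarrow\quad \tau_1\equiv\tau_2\pmod\ell .$$ -/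

import Mathlib

open ValuativeRel

noncomputable section

/-! ### The Weil group of a non-Archimedean local field

Throughout, `F` is a non-Archimedean local field (with valuation ring `𝒪[F]` and residue field
`𝓀[F]`), and `Fbar` is a separable algebraic closure of `F`. -/

section WeilGroup

variable (F Fbar : Type*) [Field F] [ValuativeRel F] [Field Fbar] [Algebra F Fbar]

/-- The ring of integers of `Fbar`: the integral closure of the valuation ring of `F`. -/
abbrev integersBar : Subalgebra 𝒪[F] Fbar := integralClosure 𝒪[F] Fbar

/-- The maximal ideal of the (local) ring of integers of the algebraic extension `Fbar / F`.
In a local ring, it is the Jacobson radical. -/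
def maxIdealBar : Ideal (integersBar F Fbar) := Ideal.jacobson ⊥

variable {F Fbar}

/-- The action of the Galois group on the ring of integers of `Fbar`. -/
def galInt (s : Fbar ≃ₐ[F] Fbar) : integersBar F Fbar ≃ₐ[𝒪[F]] integersBar F Fbar :=
  (s.restrictScalars 𝒪[F]).mapIntegralClosure

theorem galInt_mul (s t : Fbar ≃ₐ[F] Fbar) (x : integersBar F Fbar) :
    galInt (s * t) x = galInt s (galInt t x) := rfl

theorem galInt_inv_galInt (s : Fbar ≃ₐ[F] Fbar) (x : integersBar F Fbar) :
    galInt s⁻¹ (galInt s x) = x := Subtype.ext (s.symm_apply_apply _)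

theorem galInt_galInt_inv (s : Fbar ≃ₐ[F] Fbar) (x : integersBar F Fbar) :
    galInt s (galInt s⁻¹ x) = x := Subtype.ext (s.apply_symm_apply _)

theorem galInt_mem (s : Fbar ≃ₐ[F] Fbar) {x : integersBar F Fbar}
    (hx : x ∈ maxIdealBar F Fbar) : galInt s x ∈ maxIdealBar F Fbar := by
  unfold maxIdealBar at *
  rw [Ideal.mem_jacobson_bot] at *
  intro y
  have h := (hx (galInt s⁻¹ y)).map (galInt s)
  rwa [map_add, map_mul, galInt_galInt_inv, map_one] at h

/-- `s` acts on the residue field of `Fbar` as `x ↦ x ^ (q ^ n)`, where `q` is the cardinality of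
the residue field of `F`; that is, as the `n`-th power of the (arithmetic) Frobenius. -/
def ActsAsFrobPow (s : Fbar ≃ₐ[F] Fbar) (n : ℕ) : Prop :=
  ∀ x : integersBar F Fbar, galInt s x - x ^ (Nat.card 𝓀[F] ^ n) ∈ maxIdealBar F Fbar

theorem ActsAsFrobPow.mul {s t : Fbar ≃ₐ[F] Fbar} {m n : ℕ} (hs : ActsAsFrobPow s m)
    (ht : ActsAsFrobPow t n) : ActsAsFrobPow (s * t) (m + n) := by
  intro x
  have h1 := hs (galInt t x)
  have h2 := Ideal.mem_of_dvd _ (sub_dvd_pow_sub_pow (galInt t x) (x ^ (Nat.card 𝓀[F] ^ n))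
    (Nat.card 𝓀[F] ^ m)) (ht x)
  have h := add_mem h1 h2
  rwa [sub_add_sub_cancel, ← pow_mul, ← pow_add, add_comm n m] at h

theorem ActsAsFrobPow.mul_inv {s t : Fbar ≃ₐ[F] Fbar} {m k : ℕ} (hs : ActsAsFrobPow s (m + k))
    (ht : ActsAsFrobPow t m) : ActsAsFrobPow (s * t⁻¹) k := by
  intro x
  have h1 := hs (galInt t⁻¹ x)
  have h2 := ht (galInt t⁻¹ x)
  rw [galInt_galInt_inv] at h2
  have h3 := Ideal.mem_of_dvd _ (sub_dvd_pow_sub_pow x _ (Nat.card 𝓀[F] ^ k)) h2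
  have h := sub_mem h1 h3
  rw [← pow_mul, ← pow_add] at h
  rw [galInt_mul]
  convert h using 1
  ring

theorem ActsAsFrobPow.inv_mul {s t : Fbar ≃ₐ[F] Fbar} {m k : ℕ} (hs : ActsAsFrobPow s (m + k))
    (ht : ActsAsFrobPow t m) : ActsAsFrobPow (t⁻¹ * s) k := by
  intro x
  have h1 := hs x
  have h2 := ht (x ^ (Nat.card 𝓀[F] ^ k))
  rw [← pow_mul, ← pow_add, add_comm k m] at h2
  have h := galInt_mem t⁻¹ (sub_mem h1 h2)
  rw [sub_sub_sub_cancel_right, map_sub, galInt_inv_galInt] at h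
  exact h

theorem actsAsFrobPow_one : ActsAsFrobPow (1 : Fbar ≃ₐ[F] Fbar) 0 := by
  intro x
  have : galInt (1 : Fbar ≃ₐ[F] Fbar) x = x := rfl
  rw [this, pow_zero, pow_one, sub_self]
  exact zero_mem _

variable (F Fbar)

/-- The Weil group inside the Galois group: the automorphisms that act on the residue field of
`Fbar` as an integral (possibly negative) power of the Frobenius of `F`. -/
def weilSubgroup : Subgroup (Fbar ≃ₐ[F] Fbar) where
  carrier := {s | ∃ n : ℕ, ActsAsFrobPow s n ∨ ActsAsFrobPow s⁻¹ n}
  one_mem' := ⟨0, Or.inl actsAsFrobPow_one⟩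
  inv_mem' := by
    rintro s ⟨n, h⟩
    exact ⟨n, by rwa [inv_inv, or_comm]⟩
  mul_mem' := by
    rintro s t ⟨m, hs⟩ ⟨n, ht⟩
    rcases hs with hs | hs <;> rcases ht with ht | ht
    · exact ⟨m + n, Or.inl (hs.mul ht)⟩
    · rcases le_total n m with h | h <;> obtain ⟨k, rfl⟩ := Nat.exists_eq_add_of_le h
      · exact ⟨k, Or.inl (by simpa using hs.mul_inv ht)⟩
      · exact ⟨k, Or.inr (by simpa using ht.mul_inv hs)⟩
    · rcases le_total n m with h | h <;> obtain ⟨k, rfl⟩ := Nat.exists_eq_add_of_le h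
      · exact ⟨k, Or.inr (by simpa using hs.inv_mul ht)⟩
      · exact ⟨k, Or.inl (by simpa using ht.inv_mul hs)⟩
    · exact ⟨n + m, Or.inr (by simpa using ht.mul hs)⟩

/-- The Weil group `W_F` of `F`, relative to the separable algebraic closure `Fbar`. -/
def WeilGroup : Type _ := weilSubgroup F Fbar

instance : Group (WeilGroup F Fbar) := inferInstanceAs (Group (weilSubgroup F Fbar))

/-- The inclusion of the Weil group in the Galois group. -/
def WeilGroup.toGal : WeilGroup F Fbar →* (Fbar ≃ₐ[F] Fbar) := (weilSubgroup F Fbar).subtype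

/-- The inertia subgroup `I_F` of the Weil group: the elements that act trivially on the residue
field of `Fbar`. -/
def inertiaSubgroup : Subgroup (WeilGroup F Fbar) where
  carrier := {w | ∀ x : integersBar F Fbar,
    galInt (WeilGroup.toGal F Fbar w) x - x ∈ maxIdealBar F Fbar}
  one_mem' := fun x => by
    rw [map_one]
    exact (sub_self x).symm ▸ zero_mem _
  mul_mem' := by
    intro v w hv hw x
    rw [map_mul, galInt_mul]
    have h := add_mem (hv (galInt (WeilGroup.toGal F Fbar w) x)) (hw x)
    rwa [sub_add_sub_cancel] at h
  inv_mem' := by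
    intro w hw x
    have h := hw (galInt (WeilGroup.toGal F Fbar w)⁻¹ x)
    rw [galInt_galInt_inv] at h
    rw [map_inv, ← neg_mem_iff, neg_sub]
    exact h

/-- The topology of the Weil group: the coarsest one for which the inclusion in the Galois group
(with its Krull topology) is continuous and the cosets of the inertia group are open. Thus the
inertia group is open, and carries the topology induced from the Galois group. -/
instance : TopologicalSpace (WeilGroup F Fbar) :=
  TopologicalSpace.induced (WeilGroup.toGal F Fbar) inferInstance ⊓
    TopologicalSpace.induced (QuotientGroup.mk : _ → WeilGroup F Fbar ⧸ inertiaSubgroup F Fbar) ⊥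

/-- The wild inertia subgroup `P_F` of the Weil group: the elements `w` such that `w(x)/x` lies
in `1 + 𝔪` for all `x ≠ 0` in `Fbar`, where `𝔪` is the maximal ideal of the ring of integers of
`Fbar`. -/
def wildInertia : Subgroup (WeilGroup F Fbar) where
  carrier := {w | ∀ x : Fbar, ∃ y ∈ maxIdealBar F Fbar,
    WeilGroup.toGal F Fbar w x = x * (1 + (y : Fbar))}
  one_mem' := fun x => ⟨0, zero_mem _, by simp⟩
  mul_mem' := by
    intro v w hv hw x
    obtain ⟨y, hy, hxy⟩ := hw x
    obtain ⟨z, hz, hxz⟩ := hv x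
    have hy' := galInt_mem (WeilGroup.toGal F Fbar v) hy
    refine ⟨z + galInt (WeilGroup.toGal F Fbar v) y + z * galInt (WeilGroup.toGal F Fbar v) y,
      add_mem (add_mem hz hy') (Ideal.mul_mem_left _ _ hy'), ?_⟩
    have : ((galInt (WeilGroup.toGal F Fbar v) y : integersBar F Fbar) : Fbar)
      = WeilGroup.toGal F Fbar v y := rfl
    rw [map_mul, AlgEquiv.mul_apply, hxy, map_mul, hxz]
    push_cast
    rw [this, map_add, map_one]
    ring
  inv_mem' := by
    intro w hw x
    obtain ⟨y, hy, hxy⟩ := hw ((WeilGroup.toGal F Fbar w)⁻¹ x)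
    have hx : WeilGroup.toGal F Fbar w ((WeilGroup.toGal F Fbar w)⁻¹ x) = x :=
      (WeilGroup.toGal F Fbar w).apply_symm_apply x
    rw [hx] at hxy
    have hu : IsUnit (y * 1 + 1) := Ideal.mem_jacobson_bot.1 hy 1
    rw [mul_one] at hu
    obtain ⟨u, hu⟩ := hu
    refine ⟨-(y * (↑u⁻¹ : integersBar F Fbar)), neg_mem (Ideal.mul_mem_right _ _ hy), ?_⟩
    rw [map_inv]
    have h1 : (y + 1) * (↑u⁻¹ : integersBar F Fbar) = 1 := by rw [← hu, Units.mul_inv]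
    have h2 : ((y : Fbar) + 1) * ((↑u⁻¹ : integersBar F Fbar) : Fbar) = 1 := by
      have := congrArg (Subtype.val) h1
      simpa using this
    push_cast
    generalize (WeilGroup.toGal F Fbar w)⁻¹ x = z at *
    rw [hxy]
    linear_combination (z * (y : Fbar)) * h2

instance : (wildInertia F Fbar).Normal where
  conj_mem := by
    intro w hw g x
    obtain ⟨y, hy, hxy⟩ := hw ((WeilGroup.toGal F Fbar g)⁻¹ x)
    refine ⟨_, galInt_mem (WeilGroup.toGal F Fbar g) hy, ?_⟩
    have hx : WeilGroup.toGal F Fbar g ((WeilGroup.toGal F Fbar g)⁻¹ x) = x :=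
      (WeilGroup.toGal F Fbar g).apply_symm_apply x
    have : ((galInt (WeilGroup.toGal F Fbar g) y : integersBar F Fbar) : Fbar)
      = WeilGroup.toGal F Fbar g y := rfl
    rw [map_mul, map_mul, map_inv, AlgEquiv.mul_apply, AlgEquiv.mul_apply, hxy, map_mul, hx, this,
      map_add, map_one]

variable {F}

/-- For an intermediate field `E` of `Fbar / F`, finite over `F`, the Weil group `W_E` of `E`
relative to `Fbar`, viewed as an (open) subgroup of `W_F`: `W_E = W_F ∩ Gal(Fbar / E)`. (An element of
`Gal(Fbar / E)` acts trivially on the residue field of `E`, so if it acts on the residue field of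
`Fbar` as an integral power of the Frobenius of `F`, then as an integral power of that of `E`.) -/
def weilSubgroupOf (E : IntermediateField F Fbar) : Subgroup (WeilGroup F Fbar) :=
  E.fixingSubgroup.comap (WeilGroup.toGal F Fbar)

/-- The wild inertia subgroup `P_E` of `W_E`, i.e. `P_F ∩ W_E`. -/
def wildInertiaOf (E : IntermediateField F Fbar) : Subgroup (weilSubgroupOf Fbar E) :=
  (wildInertia F Fbar).subgroupOf (weilSubgroupOf Fbar E)

end WeilGroup

/-! ### Smooth representations -/

/-- A representation of a topological group is smooth if all vectors have open stabilizers. -/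
def Representation.IsSmooth {k G V : Type*} [CommRing k] [Group G] [TopologicalSpace G]
    [AddCommGroup V] [Module k V] (σ : Representation k G V) : Prop :=
  ∀ v : V, IsOpen {g : G | σ g v = v}

/-- The character `det σ` has finite order. -/
def Representation.DetFiniteOrder {k G V : Type*} [CommRing k] [Group G]
    [AddCommGroup V] [Module k V] (σ : Representation k G V) : Prop :=
  IsOfFinOrder ((LinearMap.det : (V →ₗ[k] V) →* k).comp σ)

/-- `σ` is an irreducible smooth representation of `G` that contains the irreducible representation
`β` of the subgroup `P` with multiplicity `m`, i.e. `Hom_P(β, σ)` has dimension `m`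
(for `m ≥ 1`). -/
structure IsIrreducibleSmoothOver {k G U V : Type*} [Field k] [Group G] [TopologicalSpace G]
    [AddCommGroup U] [Module k U] [AddCommGroup V] [Module k V]
    {P : Subgroup G} (β : Representation k P U) (m : ℕ) (σ : Representation k G V) : Prop where
  irreducible : σ.IsIrreducible
  smooth : σ.IsSmooth
  multiplicity : Module.finrank k (Representation.IntertwiningMap β (σ.comp P.subtype)) = m

/-! ### The isotropy field of a representation of wild inertia -/

section Isotropy

variable {F Fbar : Type*} [Field F] [ValuativeRel F] [Field Fbar] [Algebra F Fbar]
  {k U : Type*} [Field k] [AddCommGroup U] [Module k U]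

/-- The conjugate `x ↦ α (g x g⁻¹)` of the representation `α` of wild inertia. -/
def conjRep (α : Representation k (wildInertia F Fbar) U) (g : WeilGroup F Fbar) :
    Representation k (wildInertia F Fbar) U :=
  α.comp (MulAut.conjNormal g : MulAut (wildInertia F Fbar)).toMonoidHom

/-- The isotropy group in `W_F` of the isomorphism class of the representation `α`. -/
def isotropyGroup (α : Representation k (wildInertia F Fbar) U) :
    Subgroup (WeilGroup F Fbar) where
  carrier := {g | Nonempty ((conjRep α g).Equiv α)}
  one_mem' := by
    have : conjRep α 1 = α := by
      ext x : 1
      simp [conjRep]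
    exact ⟨this ▸ Representation.Equiv.refl _⟩
  mul_mem' := by
    rintro g h ⟨e⟩ ⟨f⟩
    refine ⟨Representation.Equiv.trans (ρ := conjRep α (g * h)) (σ := conjRep α h) (τ := α)
      ⟨⟨e.toLinearMap, fun x => ?_⟩, e.invFun, e.left_inv, e.right_inv⟩ f⟩
    have := e.isIntertwining' (MulAut.conjNormal h x)
    simpa [conjRep] using this
  inv_mem' := by
    rintro g ⟨e⟩
    refine ⟨Representation.Equiv.symm
      ⟨⟨e.toLinearMap, fun x => ?_⟩, e.invFun, e.left_inv, e.right_inv⟩⟩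
    have := e.isIntertwining' (MulAut.conjNormal g⁻¹ x)
    simpa [conjRep] using this

/-- The field `Z_F(α)`: the subfield of `Fbar` fixed by the isotropy group of `α`, so that the
isotropy group of `α` is the Weil group of `Z_F(α)`. -/
def isotropyField (α : Representation k (wildInertia F Fbar) U) : IntermediateField F Fbar :=
  IntermediateField.fixedField ((isotropyGroup α).map (WeilGroup.toGal F Fbar))

theorem isotropyGroup_le (α : Representation k (wildInertia F Fbar) U) :
    isotropyGroup α ≤ weilSubgroupOf Fbar (isotropyField α) := by
  intro g hg
  rw [weilSubgroupOf, Subgroup.mem_comap, IntermediateField.mem_fixingSubgroup_iff]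
  intro x hx
  exact hx ⟨_, Subgroup.mem_map_of_mem _ hg⟩

theorem wildInertia_le_isotropyGroup (α : Representation k (wildInertia F Fbar) U) :
    wildInertia F Fbar ≤ isotropyGroup α := by
  intro g hg
  have h1 : α ⟨g, hg⟩⁻¹ * α ⟨g, hg⟩ = 1 := by rw [← map_mul, inv_mul_cancel, map_one]
  have h2 : α ⟨g, hg⟩ * α ⟨g, hg⟩⁻¹ = 1 := by rw [← map_mul, mul_inv_cancel, map_one]
  refine ⟨⟨⟨α ⟨g, hg⟩⁻¹, fun x => ?_⟩, α ⟨g, hg⟩, fun v => LinearMap.congr_fun h2 v,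
    fun v => LinearMap.congr_fun h1 v⟩⟩
  have h3 : (MulAut.conjNormal g : MulAut (wildInertia F Fbar)) x = ⟨g, hg⟩ * x * ⟨g, hg⟩⁻¹ :=
    Subtype.ext rfl
  change α ⟨g, hg⟩⁻¹ * α ((MulAut.conjNormal g : MulAut (wildInertia F Fbar)) x)
    = α x * α ⟨g, hg⟩⁻¹
  rw [h3, ← map_mul, ← map_mul]
  congr 1
  group

/-- The wild inertia group `P_F` is contained in `W_E`, for `E = Z_F(α)`. -/
theorem wildInertia_le (α : Representation k (wildInertia F Fbar) U) :
    wildInertia F Fbar ≤ weilSubgroupOf Fbar (isotropyField α) :=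
  (wildInertia_le_isotropyGroup α).trans (isotropyGroup_le α)

/-- The restriction to `P_F` of a representation of `W_E`, for `E = Z_F(α)`. -/
def resWild (α : Representation k (wildInertia F Fbar) U) {V : Type*} [AddCommGroup V] [Module k V]
    (ρ : Representation k (weilSubgroupOf Fbar (isotropyField α)) V) :
    Representation k (wildInertia F Fbar) V :=
  ρ.comp (Subgroup.inclusion (wildInertia_le α))

/-- Induction `Ind_{E/F}` from `W_E` to `W_F`: the space of functions `f : W_F → V` such that
`f (h g) = σ(h) f(g)` for `h` in `W_E`, on which `W_F` acts by right translation. (As `W_E` is open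
of finite index in `W_F`, for a finite-dimensional smooth representation `σ` all these functions
are smooth.) -/
def indWeil (E : IntermediateField F Fbar) {V : Type*} [AddCommGroup V] [Module k V]
    (σ : Representation k (weilSubgroupOf Fbar E) V) :
    Representation k (WeilGroup F Fbar)
      (Representation.coindV (weilSubgroupOf Fbar E).subtype σ) :=
  Representation.coind (weilSubgroupOf Fbar E).subtype σ

end Isotropy

/-! ### Reduction modulo `ℓ` -/

/-- The `R`-module `S` is a semisimplification of the `R`-module `M`: it is semisimple, and
isomorphic to the direct sum of the successive quotients of a finite filtration of `M`. -/
def IsSemisimplification (R M S : Type*) [Ring R] [AddCommGroup M] [Module R M]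
    [AddCommGroup S] [Module R S] : Prop :=
  IsSemisimpleModule R S ∧ ∃ (n : ℕ) (c : Fin (n + 1) → Submodule R M),
    Monotone c ∧ c 0 = ⊥ ∧ c (Fin.last n) = ⊤ ∧
      Nonempty (S ≃ₗ[R] ((i : Fin n) → (c i.succ) ⧸ (c i.castSucc).submoduleOf (c i.succ)))

section ReductionModMax

variable {R G L : Type*} [CommRing R] [IsLocalRing R] [Group G] [AddCommGroup L] [Module R L]

variable (R L) in
/-- The reduction `L / 𝔪 L` of a module `L` over a local ring `R` with maximal ideal `𝔪`. -/
abbrev ModMax : Type _ := L ⧸ (IsLocalRing.maximalIdeal R • (⊤ : Submodule R L))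

instance : Module (IsLocalRing.ResidueField R) (ModMax R L) :=
  inferInstanceAs (Module (R ⧸ IsLocalRing.maximalIdeal R) (ModMax R L))

instance : IsScalarTower R (IsLocalRing.ResidueField R) (ModMax R L) :=
  inferInstanceAs (IsScalarTower R (R ⧸ IsLocalRing.maximalIdeal R) (ModMax R L))

/-- The representation of `G` on `L / 𝔪 L`, over the residue field of `R`, that is induced by a
representation of `G` on the `R`-module `L`. -/
def reductionRep (σ : Representation R G L) :
    Representation (IsLocalRing.ResidueField R) G (ModMax R L) where
  toFun g := LinearMap.extendScalarsOfSurjective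
    (IsLocalRing.residue_surjective :
      Function.Surjective (algebraMap R (IsLocalRing.ResidueField R)))
    (Submodule.mapQ _ _ (σ g) (Submodule.smul_top_le_comap_smul_top _ (σ g)))
  map_one' := by
    refine LinearMap.ext fun x => ?_
    obtain ⟨x, rfl⟩ := Submodule.mkQ_surjective _ x
    exact congrArg (Submodule.mkQ _) (LinearMap.congr_fun (map_one σ) x)
  map_mul' g h := by
    refine LinearMap.ext fun x => ?_
    obtain ⟨x, rfl⟩ := Submodule.mkQ_surjective _ x
    exact congrArg (Submodule.mkQ _) (LinearMap.congr_fun (map_mul σ g h) x)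

end ReductionModMax

section Reduction

variable (ℓ : ℕ) [Fact ℓ.Prime]

/-- The integral closure of `ℤ_ℓ` in the algebraic closure of `ℚ_ℓ`. -/
abbrev Zbar : Subalgebra ℤ_[ℓ] (PadicAlgCl ℓ) := integralClosure ℤ_[ℓ] (PadicAlgCl ℓ)

theorem mem_Zbar_iff (x : PadicAlgCl ℓ) : x ∈ Zbar ℓ ↔ ‖x‖ ≤ 1 := by
  have hx : IsIntegral ℚ_[ℓ] x := Algebra.IsIntegral.isIntegral x
  rw [← PadicAlgCl.spectralNorm_eq, spectralNorm, spectralValue_le_one_iff (minpoly.monic hx),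
    mem_integralClosure_iff]
  constructor
  · intro h n
    rw [minpoly.isIntegrallyClosed_eq_field_fractions' ℚ_[ℓ] h, Polynomial.coeff_map]
    exact ((minpoly ℤ_[ℓ] x).coeff n).2
  · intro h
    have hl : minpoly ℚ_[ℓ] x ∈ Polynomial.lifts (algebraMap ℤ_[ℓ] ℚ_[ℓ]) := by
      rw [Polynomial.lifts_iff_coeff_lifts]
      exact fun n => ⟨⟨_, h n⟩, rfl⟩
    obtain ⟨q, hq, -, hm⟩ := Polynomial.lifts_and_degree_eq_and_monic hl (minpoly.monic hx)
    refine ⟨q, hm, ?_⟩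
    have h0 := minpoly.aeval ℚ_[ℓ] x
    rw [← hq, Polynomial.aeval_map_algebraMap] at h0
    exact h0

theorem isUnit_Zbar_of_norm_eq_one {x : Zbar ℓ} (hx : ‖(x : PadicAlgCl ℓ)‖ = 1) : IsUnit x := by
  have h0 : (x : PadicAlgCl ℓ) ≠ 0 := by
    intro h
    rw [h, norm_zero] at hx
    exact zero_ne_one hx
  have hi : (x : PadicAlgCl ℓ)⁻¹ ∈ Zbar ℓ := by rw [mem_Zbar_iff, norm_inv, hx, inv_one]
  exact IsUnit.of_mul_eq_one ⟨_, hi⟩ (Subtype.ext (mul_inv_cancel₀ h0))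

instance : IsLocalRing (Zbar ℓ) := by
  refine IsLocalRing.of_isUnit_or_isUnit_of_isUnit_add ?_
  intro a b hab
  by_contra! hn
  have key : ∀ c : Zbar ℓ, ¬ IsUnit c → ‖(c : PadicAlgCl ℓ)‖ < 1 := fun c hc =>
    lt_of_le_of_ne ((mem_Zbar_iff ℓ c).1 c.2) (fun h => hc (isUnit_Zbar_of_norm_eq_one ℓ h))
  obtain ⟨u, hu⟩ := hab.exists_right_inv
  have h1 : ((a : PadicAlgCl ℓ) + b) * u = 1 := congrArg Subtype.val hu
  have h2 : ‖(a : PadicAlgCl ℓ) + b‖ < 1 :=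
    lt_of_le_of_lt (IsUltrametricDist.norm_add_le_max _ _) (max_lt (key a hn.1) (key b hn.2))
  have h3 : ‖(a : PadicAlgCl ℓ) + b‖ * ‖(u : PadicAlgCl ℓ)‖ = 1 := by
    rw [← norm_mul, h1, norm_one]
  have h4 := (mem_Zbar_iff ℓ u).1 u.2
  have h5 := norm_nonneg ((a : PadicAlgCl ℓ) + b)
  have h6 := norm_nonneg (u : PadicAlgCl ℓ)
  nlinarith

/-- The residue field of `Zbar ℓ`, an algebraic closure of the field with `ℓ` elements. -/
abbrev ResBar : Type := IsLocalRing.ResidueField (Zbar ℓ)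

variable {ℓ} {G V : Type*} [Group G] [AddCommGroup V] [Module (PadicAlgCl ℓ) V]

/-- `L` is a `Zbar G`-lattice in the representation `σ`: a finitely generated `Zbar`-submodule that
spans `V` over the algebraic closure of `ℚ_ℓ` and is stable under `G`. -/
structure IsStableLattice (σ : Representation (PadicAlgCl ℓ) G V) (L : Submodule (Zbar ℓ) V) :
    Prop where
  fg : L.FG
  span_eq_top : Submodule.span (PadicAlgCl ℓ) (L : Set V) = ⊤
  stable : ∀ g : G, ∀ v ∈ L, σ g v ∈ L

/-- The action of `G` on a `Zbar G`-lattice. -/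
def latticeRep (σ : Representation (PadicAlgCl ℓ) G V) {L : Submodule (Zbar ℓ) V}
    (hL : IsStableLattice σ L) : Representation (Zbar ℓ) G L where
  toFun g := ((σ g).restrictScalars (Zbar ℓ)).restrict (hL.stable g)
  map_one' := LinearMap.ext fun v => Subtype.ext (by simp [LinearMap.restrict_apply])
  map_mul' g h := LinearMap.ext fun v => Subtype.ext (LinearMap.congr_fun (map_mul σ g h) v)

/-- The class `[σ]_ℓ^ss`: the isomorphism class of semisimple representations of `G` over the
residue field of `Zbar` (realized in coordinates) that are a semisimplification of `L / 𝔪 L`, for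
some `Zbar G`-lattice `L` in `σ`. -/
def reductionClass (σ : Representation (PadicAlgCl ℓ) G V) :
    Set (Σ n : ℕ, Representation (ResBar ℓ) G (Fin n → ResBar ℓ)) :=
  {S | ∃ (L : Submodule (Zbar ℓ) V) (hL : IsStableLattice σ L),
    IsSemisimplification (MonoidAlgebra (ResBar ℓ) G)
      (reductionRep (latticeRep σ hL)).asModule S.2.asModule}

/-- Congruence modulo `ℓ`: `σ₁ ≡ σ₂ (mod ℓ)` means that `[σ₁]_ℓ^ss = [σ₂]_ℓ^ss`. -/
def CongruentMod {V' : Type*} [AddCommGroup V'] [Module (PadicAlgCl ℓ) V']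
    (σ₁ : Representation (PadicAlgCl ℓ) G V) (σ₂ : Representation (PadicAlgCl ℓ) G V') : Prop :=
  reductionClass σ₁ = reductionClass σ₂

end Reduction

end

/-!
The congruence of two representations with finite image is a statement about traces. A
semisimple representation over the residue field of `Zbar ℓ` is determined by its characteristic
polynomials (Brauer–Nesbitt, `nonempty_linearEquiv_of_actCharpoly_eq`), and those of the reduction
of a lattice are the reductions of those of the lattice; so `σ₁ ≡ σ₂` means that `σ₁ g` and `σ₂ g`
have the same characteristic polynomial modulo the maximal ideal, for all `g`. Roots of unity of
order prime to `ℓ` are determined by their reductions, and in characteristic `ℓ` the characteristic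
polynomial of `f ^ ℓ ^ a` determines that of `f`. Hence `σ₁ ≡ σ₂` if and only if `σ₁` and `σ₂` have
equal traces at all `g` that act with order prime to `ℓ` (`congruentMod_iff_trace`).

Write `W`, `P`, `H` for the Weil group of `F`, its wild inertia group, and the Weil group of the
isotropy field of `α`. If the traces of `τ₁` and `τ₂` agree at the elements of order prime to `ℓ`,
then so do those of the induced representations, by Frobenius' formula (`trace_coind`). Conversely,
let `h` in `H` have order prime to `ℓ` in a finite quotient of `W` through which all the induced
representations factor. As the finite quotients of `P` have order prime to `ℓ`, the same is true of
all the elements of the coset `P h`, so the traces of the induced representations agree on this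
coset. Pairing the trace of the representation induced from
`ρ ⊗ τ` with the trace of `ρ` along the coset gives a multiple of the trace of `τ` at `h`
(`sum_trace_mul_trace_coind`): by Schur orthogonality for the irreducible representation `ρ|P`, the
other cosets of `H` contribute zero, because the corresponding conjugates of `ρ|P` are not
isomorphic to it. This is `congruentMod_coind_tprod_iff`, for an abstract group.

For the Weil group, it has to be known that the isotropy group of `α` is open and equal to `H`
(`isotropyGroup_eq`), that the finite quotients of `P` have order prime to `ℓ`
(`exists_coprime_pow_mem_weilSubgroupOf`), that `α`, `τ₁` and `τ₂` are finite-dimensional and the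
`τᵢ` are trivial on `P`, and that an irreducible smooth representation with determinant of finite
order has finite image (`Representation.IsSmooth.finite_range`).
-/

noncomputable section

/-! ### Characteristic polynomials and exact sequences -/

theorem LinearMap.charpoly_eq_restrict_mul_mapQ {k M : Type*} [Field k] [AddCommGroup M]
    [Module k M] [FiniteDimensional k M] (f : M →ₗ[k] M) (N : Submodule k M)
    (h : ∀ x ∈ N, f x ∈ N) :
    f.charpoly = (f.restrict h).charpoly * (N.mapQ N f h).charpoly := by
  classical
  let bN := Module.finBasis k N
  let bQ := Module.finBasis k (M ⧸ N)
  let b := Module.Basis.sumQuot bN bQ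
  rw [← LinearMap.charpoly_toMatrix f b, ← LinearMap.charpoly_toMatrix (f.restrict h) bN,
    ← LinearMap.charpoly_toMatrix (N.mapQ N f h) bQ,
    ← Matrix.fromBlocks_toBlocks (LinearMap.toMatrix b b f)]
  have h21 : (LinearMap.toMatrix b b f).toBlocks₂₁ = 0 := by
    ext i j
    have : N.mkQ (f (bN j)) = 0 := by simpa using h _ (bN j).2
    simp [Matrix.toBlocks₂₁, LinearMap.toMatrix_apply, b, Module.Basis.sumQuot_repr_inr, this,
      -Submodule.mkQ_apply]
  rw [h21, Matrix.charpoly_fromBlocks_zero₂₁]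
  congr 2
  · ext i j
    have := Module.Basis.sumQuot_repr_inl_of_mem bN bQ (f (bN j)) (h _ (bN j).2) i
    simp [Matrix.toBlocks₁₁, LinearMap.toMatrix_apply, b, this]
    rfl
  · ext i j
    simp only [Matrix.toBlocks₂₂, LinearMap.toMatrix_apply, b, Matrix.of_apply,
      Module.Basis.sumQuot_repr_inr]
    rw [← Module.Basis.sumQuot_inr bN bQ j]
    rfl

theorem LinearMap.charpoly_pi_fin {k : Type*} [Field k] {n : ℕ} (V : Fin n → Type*)
    [∀ i, AddCommGroup (V i)] [∀ i, Module k (V i)] [∀ i, FiniteDimensional k (V i)]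
    (f : ∀ i, V i →ₗ[k] V i) :
    (LinearMap.pi fun i => f i ∘ₗ LinearMap.proj i).charpoly = ∏ i, (f i).charpoly := by
  induction n with
  | zero =>
    rw [Finset.univ_eq_empty, Finset.prod_empty,
      ← LinearMap.charpoly_toMatrix _ (Module.Basis.empty (ι := Empty) ((i : Fin 0) → V i))]
    exact Matrix.charpoly_isEmpty
  | succ n ih =>
    rw [Fin.prod_univ_succ, ← ih (fun i => V i.succ) (fun i => f i.succ),
      ← LinearMap.charpoly_prodMap, ← (Fin.consLinearEquiv k V).charpoly_conj]
    congr 1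
    refine LinearMap.ext fun x => funext fun i => ?_
    refine Fin.cases ?_ (fun i => ?_) i
    · simp [LinearEquiv.conj_apply, Fin.consLinearEquiv]
    · simp [LinearEquiv.conj_apply, Fin.consLinearEquiv, Fin.tail]

theorem LinearMap.trace_eq_neg_nextCoeff_charpoly {k V : Type*} [Field k] [AddCommGroup V]
    [Module k V] [FiniteDimensional k V] (f : Module.End k V) :
    LinearMap.trace k V f = -f.charpoly.nextCoeff := by
  classical
  rw [LinearMap.trace_eq_matrix_trace k (Module.finBasis k V),
    Matrix.trace_eq_neg_charpoly_nextCoeff, LinearMap.charpoly_toMatrix]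

/-- The characteristic polynomial of an element of an algebra acting on a module. -/
def actCharpoly (k : Type*) {R : Type*} [Field k] [Ring R] [Algebra k R] (M : Type*)
    [AddCommGroup M] [Module k M] [Module R M] [IsScalarTower k R M] [FiniteDimensional k M]
    (r : R) : Polynomial k :=
  (Algebra.lsmul k k M r).charpoly

/-- The trace of an element of an algebra acting on a module. -/
def actTrace (k : Type*) {R : Type*} [Field k] [Ring R] [Algebra k R] (M : Type*)
    [AddCommGroup M] [Module k M] [Module R M] [IsScalarTower k R M] : R →ₗ[k] k :=
  LinearMap.trace k M ∘ₗ (Algebra.lsmul k k M).toLinearMap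

section Act

variable {k R : Type*} [Field k] [Ring R] [Algebra k R]
  {M : Type*} [AddCommGroup M] [Module k M] [Module R M] [IsScalarTower k R M]
  {N : Type*} [AddCommGroup N] [Module k N] [Module R N] [IsScalarTower k R N]

theorem conj_lsmul (e : M ≃ₗ[R] N) (r : R) :
    (e.restrictScalars k).conj (Algebra.lsmul k k M r) = Algebra.lsmul k k N r := by
  ext x
  simp [LinearEquiv.conj_apply]

theorem actTrace_congr (e : M ≃ₗ[R] N) : actTrace k M (R := R) = actTrace k N := by
  ext r
  simp only [actTrace, LinearMap.comp_apply, AlgHom.toLinearMap_apply]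
  rw [← conj_lsmul e r, LinearMap.trace_conj']

variable [FiniteDimensional k M] [FiniteDimensional k N]

theorem actCharpoly_congr (e : M ≃ₗ[R] N) (r : R) : actCharpoly k M r = actCharpoly k N r := by
  rw [actCharpoly, actCharpoly, ← conj_lsmul e r, LinearEquiv.charpoly_conj]

theorem actCharpoly_monic (r : R) : (actCharpoly k M r).Monic := LinearMap.charpoly_monic _

theorem actTrace_eq (r : R) : actTrace k M r = -(actCharpoly k M r).nextCoeff :=
  LinearMap.trace_eq_neg_nextCoeff_charpoly _

theorem actCharpoly_pi_fin {n : ℕ} (V : Fin n → Type*)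
    [∀ i, AddCommGroup (V i)] [∀ i, Module k (V i)] [∀ i, FiniteDimensional k (V i)]
    [∀ i, Module R (V i)] [∀ i, IsScalarTower k R (V i)] (r : R) :
    actCharpoly k (∀ i, V i) r = ∏ i, actCharpoly k (V i) r := by
  exact LinearMap.charpoly_pi_fin V (fun i => Algebra.lsmul k k (V i) r)

instance (P : Submodule R M) : FiniteDimensional k P :=
  inferInstanceAs (FiniteDimensional k (P.restrictScalars k))

instance (P : Submodule R M) : FiniteDimensional k (M ⧸ P) :=
  Module.Finite.of_surjective (P.mkQ.restrictScalars k) P.mkQ_surjective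

theorem actCharpoly_submodule_mul_quotient (P : Submodule R M) (r : R) :
    actCharpoly k M r = actCharpoly k P r * actCharpoly k (M ⧸ P) r :=
  LinearMap.charpoly_eq_restrict_mul_mapQ (Algebra.lsmul k k M r) (P.restrictScalars k)
    (fun _ hx => P.smul_mem r hx)

/-! ### Independence of the traces of simple modules -/

/-- By the density theorem, an element of the algebra can act with trace one on a given simple
module and as zero on finitely many other ones. -/
theorem exists_actTrace_eq_one [IsAlgClosed k] {ι : Type*} [Finite ι] (V : ι → Type*)
    [∀ i, AddCommGroup (V i)] [∀ i, Module k (V i)] [∀ i, FiniteDimensional k (V i)]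
    [∀ i, Module R (V i)] [∀ i, IsScalarTower k R (V i)] [∀ i, IsSimpleModule R (V i)]
    (hV : ∀ i j, Nonempty (V i ≃ₗ[R] V j) → i = j) (q : ι) :
    ∃ r : R, actTrace k (V q) r = 1 ∧ ∀ j, j ≠ q → actTrace k (V j) r = 0 := by
  classical
  have := Fintype.ofFinite ι
  obtain ⟨φ, hφ⟩ : ∃ φ : V q →ₗ[k] V q, LinearMap.trace k _ φ = 1 := by
    have : Nontrivial (V q) := IsSimpleModule.nontrivial R (V q)
    obtain ⟨v, hv⟩ := exists_ne (0 : V q)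
    obtain ⟨f, hf⟩ := not_forall.1 (mt (Module.forall_dual_apply_eq_zero_iff k v).1 hv)
    exact ⟨((f v)⁻¹ • f).smulRight v, by
      rw [LinearMap.trace_smulRight, LinearMap.smul_apply, smul_eq_mul, inv_mul_cancel₀ hf]⟩
  -- By Schur's lemma, an endomorphism of the sum acts on the component `V q` as a scalar.
  have key : ∀ g : Module.End R (∀ i, V i), ∃ c : k,
      (∀ x, g x q = c • x q) ∧ ∀ v, g (Pi.single q v) = Pi.single q (c • v) := by
    intro g
    have hz : ∀ i j, i ≠ j →
        (LinearMap.proj i ∘ₗ g ∘ₗ LinearMap.single R V j : V j →ₗ[R] V i) = 0 := by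
      intro i j hij
      refine ((LinearMap.bijective_or_eq_zero _).resolve_left fun hb => hij ?_)
      exact (hV j i ⟨LinearEquiv.ofBijective _ hb⟩).symm
    obtain ⟨c, hc⟩ := (IsSimpleModule.algebraMap_end_bijective_of_isAlgClosed k
      (A := R) (V := V q)).2 (LinearMap.proj q ∘ₗ g ∘ₗ LinearMap.single R V q)
    have hc' : ∀ v, g (Pi.single q v) q = c • v := fun v => (LinearMap.congr_fun hc v).symm
    refine ⟨c, fun x => ?_, fun v => ?_⟩
    · conv_lhs => rw [← Finset.univ_sum_single x, map_sum, Finset.sum_apply]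
      rw [Finset.sum_eq_single_of_mem (f := fun j => g (Pi.single j (x j)) q) q
        (Finset.mem_univ q) (fun j _ hj => LinearMap.congr_fun (hz q j hj.symm) (x j)), hc']
    · ext i
      rcases eq_or_ne i q with rfl | hi
      · rw [hc', Pi.single_eq_same]
      · rw [Pi.single_eq_of_ne hi]
        exact LinearMap.congr_fun (hz i q hi) v
  -- Hence `φ` on `V q`, extended by zero, commutes with all endomorphisms of the sum.
  let f : Module.End (Module.End R (∀ i, V i)) (∀ i, V i) :=
    { toFun := fun x => Pi.single q (φ (x q))
      map_add' := fun x y => by simp [Pi.single_add]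
      map_smul' := fun g x => by
        obtain ⟨c, h1, h2⟩ := key g
        simp [h1, h2] }
  obtain ⟨r, hr⟩ := jacobson_density f
    (Finset.univ.image (Module.finBasis k (∀ i, V i)))
  have hr' : ∀ x : ∀ i, V i, r • x = Pi.single q (φ (x q)) := by
    have : Algebra.lsmul k k (∀ i, V i) r =
        LinearMap.single k V q ∘ₗ φ ∘ₗ LinearMap.proj q := by
      refine (Module.finBasis k (∀ i, V i)).ext fun i => ?_
      exact (hr _ (Finset.mem_image_of_mem _ (Finset.mem_univ i))).symm
    exact fun x => LinearMap.congr_fun this x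
  refine ⟨r, ?_, fun j hj => ?_⟩
  · have : Algebra.lsmul k k (V q) r = φ := by
      ext v
      have := congrFun (hr' (Pi.single q v)) q
      simpa using this
    simp [actTrace, this, hφ]
  · have : Algebra.lsmul k k (V j) r = 0 := by
      ext v
      have := congrFun (hr' (Pi.single j v)) j
      simpa [hj, hj.symm] using this
    simp [actTrace, this]

/-- The traces of pairwise non-isomorphic simple modules are linearly independent, even as
functions on a spanning set of the algebra. -/
theorem eq_zero_of_sum_mul_actTrace [IsAlgClosed k] {ι : Type*} [Fintype ι] (V : ι → Type*)
    [∀ i, AddCommGroup (V i)] [∀ i, Module k (V i)] [∀ i, FiniteDimensional k (V i)]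
    [∀ i, Module R (V i)] [∀ i, IsScalarTower k R (V i)] [∀ i, IsSimpleModule R (V i)]
    (hV : ∀ i j, Nonempty (V i ≃ₗ[R] V j) → i = j) {X : Set R} (hX : Submodule.span k X = ⊤)
    (c : ι → k) (hc : ∀ x ∈ X, ∑ i, c i * actTrace k (V i) x = 0) (q : ι) : c q = 0 := by
  have h0 : (∑ i, c i • actTrace k (V i) : R →ₗ[k] k) = 0 :=
    LinearMap.ext_on hX fun x hx => by simpa using hc x hx
  obtain ⟨r, h1, h2⟩ := exists_actTrace_eq_one (k := k) V hV q
  have := LinearMap.congr_fun h0 r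
  simp only [LinearMap.sum_apply, LinearMap.smul_apply, smul_eq_mul, LinearMap.zero_apply] at this
  rwa [Finset.sum_eq_single q (fun j _ hj => by rw [h2 j hj, mul_zero]) (by simp), h1,
    mul_one] at this

omit [FiniteDimensional k M] [FiniteDimensional k N] in
/-- Two semisimple modules are sums of members of one finite family of pairwise non-isomorphic
simple modules. -/
theorem exists_common_decomposition [IsSemisimpleModule R M] [IsSemisimpleModule R N]
    [Module.Finite R M] [Module.Finite R N] :
    ∃ (n m : ℕ) (Q : Type) (_ : Fintype Q) (V : Q → Submodule R (M × N)) (c : Fin n → Q)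
      (d : Fin m → Q), (∀ q, IsSimpleModule R (V q)) ∧
      (∀ p q, Nonempty (V p ≃ₗ[R] V q) → p = q) ∧
      Nonempty (M ≃ₗ[R] ((i : Fin n) → V (c i))) ∧ Nonempty (N ≃ₗ[R] ((i : Fin m) → V (d i))) := by
  classical
  obtain ⟨n, S, eM, hS⟩ := IsSemisimpleModule.exists_linearEquiv_fin_dfinsupp R M
  obtain ⟨m, T, eN, hT⟩ := IsSemisimpleModule.exists_linearEquiv_fin_dfinsupp R N
  let U : Fin n ⊕ Fin m → Submodule R (M × N) :=
    Sum.elim (fun i => (S i).map (LinearMap.inl R M N)) (fun i => (T i).map (LinearMap.inr R M N))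
  have eS : ∀ i, Nonempty (S i ≃ₗ[R] U (.inl i)) := fun i =>
    ⟨Submodule.equivMapOfInjective _ LinearMap.inl_injective _⟩
  have eT : ∀ i, Nonempty (T i ≃ₗ[R] U (.inr i)) := fun i =>
    ⟨Submodule.equivMapOfInjective _ LinearMap.inr_injective _⟩
  have hU : ∀ i, IsSimpleModule R (U i) := by
    rintro (i | i)
    · have := hS i
      exact IsSimpleModule.congr (eS i).some.symm
    · have := hT i
      exact IsSimpleModule.congr (eT i).some.symm
  -- The family consists of one member of each isomorphism class among the simple summands.
  let s : Setoid (Fin n ⊕ Fin m) :=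
    { r := fun i j => Nonempty (U i ≃ₗ[R] U j)
      iseqv := ⟨fun i => ⟨.refl _ _⟩, fun ⟨e⟩ => ⟨e.symm⟩, fun ⟨e⟩ ⟨f⟩ => ⟨e.trans f⟩⟩ }
  have hout : ∀ i, Nonempty (U i ≃ₗ[R] U (Quotient.out (Quotient.mk s i))) := fun i =>
    s.symm (Quotient.mk_out (s := s) i)
  refine ⟨n, m, Quotient s, inferInstance, fun q => U q.out, fun i => Quotient.mk s (.inl i),
    fun i => Quotient.mk s (.inr i), fun q => hU _, fun p q h => ?_, ⟨?_⟩, ⟨?_⟩⟩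
  · rw [← Quotient.out_eq p, ← Quotient.out_eq q]
    exact Quotient.sound h
  · exact eM.trans (DFinsupp.linearEquivFunOnFintype.trans
      (LinearEquiv.piCongrRight fun i => (eS i).some.trans (hout _).some))
  · exact eN.trans (DFinsupp.linearEquivFunOnFintype.trans
      (LinearEquiv.piCongrRight fun i => (eT i).some.trans (hout _).some))

omit [Algebra k R] [Field k] in
theorem nonempty_pi_linearEquiv_of_card_fiber_eq {n m : ℕ} {Q : Type*} [DecidableEq Q]
    (V : Q → Type*) [∀ q, AddCommGroup (V q)] [∀ q, Module R (V q)] (c : Fin n → Q)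
    (d : Fin m → Q) (h : ∀ q, (Finset.univ.filter fun i => c i = q).card =
      (Finset.univ.filter fun i => d i = q).card) :
    Nonempty (((i : Fin n) → V (c i)) ≃ₗ[R] ((i : Fin m) → V (d i))) := by
  have e : ∀ q, {i // c i = q} ≃ {i // d i = q} := fun q =>
    Fintype.equivOfCardEq (by rw [Fintype.card_subtype, Fintype.card_subtype, h q])
  let f : Fin n ≃ Fin m :=
    (Equiv.sigmaFiberEquiv c).symm.trans ((Equiv.sigmaCongrRight e).trans (Equiv.sigmaFiberEquiv d))
  have hf : ∀ i, d (f i) = c i := fun i => (e (c i) ⟨i, rfl⟩).2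
  have e1 : ((i : Fin n) → V (c i)) ≃ₗ[R] ((i : Fin n) → V (d (f i))) := by
    exact (funext hf : (fun i => d (f i)) = c) ▸ .refl _ _
  exact ⟨e1.trans (LinearEquiv.piCongrLeft R (fun i => V (d i)) f)⟩

end Act

/-! ### Recovering semisimple modules from characteristic polynomials -/

section BrauerNesbitt

variable {k R : Type*} [Field k] [IsAlgClosed k] [Ring R] [Algebra k R]
  {M : Type*} [AddCommGroup M] [Module k M] [Module R M] [IsScalarTower k R M]
  {N : Type*} [AddCommGroup N] [Module k N] [Module R N] [IsScalarTower k R N]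

/-- If the multiplicities `a` and `b` give the same characteristic polynomials, then they agree in
the field, by comparison of the second highest coefficients. -/
theorem natCast_eq_of_prod_actCharpoly_pow_eq {Q : Type*} [Fintype Q] (V : Q → Type*)
    [∀ i, AddCommGroup (V i)] [∀ i, Module k (V i)] [∀ i, FiniteDimensional k (V i)]
    [∀ i, Module R (V i)] [∀ i, IsScalarTower k R (V i)] [∀ i, IsSimpleModule R (V i)]
    (hV : ∀ i j, Nonempty (V i ≃ₗ[R] V j) → i = j) {X : Set R} (hX : Submodule.span k X = ⊤)
    (a b : Q → ℕ) (h : ∀ x ∈ X, ∏ q, actCharpoly k (V q) x ^ a q = ∏ q, actCharpoly k (V q) x ^ b q)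
    (q : Q) : (a q : k) = b q := by
  rw [← sub_eq_zero]
  refine eq_zero_of_sum_mul_actTrace V hV hX (fun q => (a q : k) - b q) (fun x hx => ?_) q
  have hn : ∀ c : Q → ℕ, (∏ q, actCharpoly k (V q) x ^ c q).nextCoeff
      = -∑ q, (c q : k) * actTrace k (V q) x := by
    intro c
    rw [Polynomial.Monic.nextCoeff_prod _ _ fun q _ => (actCharpoly_monic x).pow _,
      ← Finset.sum_neg_distrib]
    refine Finset.sum_congr rfl fun q _ => ?_
    rw [(actCharpoly_monic x).nextCoeff_pow, actTrace_eq, nsmul_eq_mul, mul_neg, neg_neg]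
  have := congrArg Polynomial.nextCoeff (h x hx)
  rw [hn, hn, neg_inj] at this
  simp_rw [sub_mul, Finset.sum_sub_distrib, this, sub_self]

/-- If the multiplicities `a` and `b` give the same characteristic polynomials, then they agree
modulo every power of the characteristic: independence of traces gives congruence modulo `ℓ`;
after cancelling the remainders, both products are `ℓ`-th powers, of which the roots can be
extracted in `k[X]`. -/
theorem modEq_pow_of_prod_actCharpoly_pow_eq (ℓ : ℕ) [Fact ℓ.Prime] [CharP k ℓ]
    {Q : Type*} [Fintype Q] (V : Q → Type*)
    [∀ i, AddCommGroup (V i)] [∀ i, Module k (V i)] [∀ i, FiniteDimensional k (V i)]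
    [∀ i, Module R (V i)] [∀ i, IsScalarTower k R (V i)] [∀ i, IsSimpleModule R (V i)]
    (hV : ∀ i j, Nonempty (V i ≃ₗ[R] V j) → i = j) {X : Set R} (hX : Submodule.span k X = ⊤)
    (n : ℕ) (a b : Q → ℕ)
    (h : ∀ x ∈ X, ∏ q, actCharpoly k (V q) x ^ a q = ∏ q, actCharpoly k (V q) x ^ b q)
    (q : Q) : a q ≡ b q [MOD ℓ ^ n] := by
  induction n generalizing a b with
  | zero => simp [Nat.modEq_one]
  | succ n ih =>
    have h1 : ∀ q, a q % ℓ = b q % ℓ := fun q =>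
      (CharP.natCast_eq_natCast k ℓ).1 (natCast_eq_of_prod_actCharpoly_pow_eq V hV hX a b h q)
    have h2 : ∀ (c : Q → ℕ) (x : R), ∏ q, actCharpoly k (V q) x ^ c q =
        (∏ q, actCharpoly k (V q) x ^ (c q / ℓ)) ^ ℓ * ∏ q, actCharpoly k (V q) x ^ (c q % ℓ) := by
      intro c x
      rw [← Finset.prod_pow, ← Finset.prod_mul_distrib]
      refine Finset.prod_congr rfl fun q _ => ?_
      rw [← pow_mul, ← pow_add, mul_comm (c q / ℓ), Nat.div_add_mod]
    have h3 := ih (fun q => a q / ℓ) (fun q => b q / ℓ) (fun x hx => by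
      have h4 := h x hx
      rw [h2 a, h2 b] at h4
      simp_rw [h1] at h4
      have h5 := mul_right_cancel₀ (Polynomial.Monic.ne_zero
        (Polynomial.monic_prod_of_monic _ _ fun q _ => (actCharpoly_monic x).pow _)) h4
      exact frobenius_inj (Polynomial k) ℓ h5)
    have h6 := h3.mul_left' ℓ
    rw [← pow_succ'] at h6
    have h7 := h6.add_right (a q % ℓ)
    rw [Nat.div_add_mod, h1, Nat.div_add_mod] at h7
    exact h7

variable [FiniteDimensional k M] [FiniteDimensional k N] [IsSemisimpleModule R M]
  [IsSemisimpleModule R N]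

/-- The Brauer–Nesbitt theorem: in characteristic `ℓ`, a semisimple module is determined by the
characteristic polynomials of the elements of a spanning set of the algebra. -/
theorem nonempty_linearEquiv_of_actCharpoly_eq (ℓ : ℕ) [Fact ℓ.Prime] [CharP k ℓ] {X : Set R}
    (hX : Submodule.span k X = ⊤) (h : ∀ x ∈ X, actCharpoly k M x = actCharpoly k N x) :
    Nonempty (M ≃ₗ[R] N) := by
  classical
  have := Module.Finite.of_restrictScalars_finite k R M
  have := Module.Finite.of_restrictScalars_finite k R N
  obtain ⟨n, m, Q, _, V, c, d, hs, hV, ⟨eM⟩, ⟨eN⟩⟩ := exists_common_decomposition (R := R)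
    (M := M) (N := N)
  have hp : ∀ {n : ℕ} (c : Fin n → Q) (x : R), actCharpoly k ((i : Fin n) → V (c i)) x =
      ∏ q, actCharpoly k (V q) x ^ (Finset.univ.filter fun i => c i = q).card := by
    intro n c x
    rw [actCharpoly_pi_fin (fun i => V (c i)), ← Finset.prod_fiberwise Finset.univ c]
    refine Finset.prod_congr rfl fun q _ => Finset.prod_eq_pow_card fun i hi => ?_
    rw [(Finset.mem_filter.1 hi).2]
  have key := fun N => modEq_pow_of_prod_actCharpoly_pow_eq ℓ (fun q => V q) hV hX N
    (fun q => (Finset.univ.filter fun i => c i = q).card)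
    (fun q => (Finset.univ.filter fun i => d i = q).card) (fun x hx => by
      rw [← hp c, ← hp d, ← actCharpoly_congr eM, ← actCharpoly_congr eN, h x hx])
  refine ⟨eM.trans ((nonempty_pi_linearEquiv_of_card_fiber_eq (fun q => V q) c d
    fun q => ?_).some.trans eN.symm)⟩
  -- The multiplicities are at most `n` and `m`, so congruence modulo `ℓ ^ s` is equality.
  obtain ⟨s, hs⟩ := pow_unbounded_of_one_lt (n + m) (Fact.out : ℓ.Prime).one_lt
  have h1 := (Finset.card_filter_le Finset.univ fun i => c i = q)
  have h2 := (Finset.card_filter_le Finset.univ fun i => d i = q)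
  rw [Finset.card_univ, Fintype.card_fin] at h1 h2
  exact (key s q).eq_of_lt_of_lt (by omega) (by omega)

/-- In characteristic zero, a semisimple module is determined by its traces. -/
theorem nonempty_linearEquiv_of_actTrace_eq [CharZero k] {X : Set R}
    (hX : Submodule.span k X = ⊤) (h : ∀ x ∈ X, actTrace k M x = actTrace k N x) :
    Nonempty (M ≃ₗ[R] N) := by
  classical
  have := Module.Finite.of_restrictScalars_finite k R M
  have := Module.Finite.of_restrictScalars_finite k R N
  obtain ⟨n, m, Q, _, V, c, d, hs, hV, ⟨eM⟩, ⟨eN⟩⟩ := exists_common_decomposition (R := R)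
    (M := M) (N := N)
  have hp : ∀ {n : ℕ} (c : Fin n → Q) (x : R), actTrace k ((i : Fin n) → V (c i)) x =
      ∑ q, ((Finset.univ.filter fun i => c i = q).card : k) * actTrace k (V q) x := by
    intro n c x
    have h1 := actCharpoly_pi_fin (k := k) (fun i => V (c i)) x
    rw [actTrace_eq, h1, Polynomial.Monic.nextCoeff_prod _ _ fun q _ => actCharpoly_monic x,
      ← Finset.sum_neg_distrib, ← Finset.sum_fiberwise Finset.univ c]
    refine Finset.sum_congr rfl fun q _ => ?_
    rw [← nsmul_eq_mul]
    refine Finset.sum_eq_card_nsmul fun i hi => ?_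
    rw [← actTrace_eq, (Finset.mem_filter.1 hi).2]
  refine ⟨eM.trans ((nonempty_pi_linearEquiv_of_card_fiber_eq (fun q => V q) c d
    fun q => ?_).some.trans eN.symm)⟩
  refine Nat.cast_injective (R := k) (sub_eq_zero.1 ?_)
  refine eq_zero_of_sum_mul_actTrace (fun q => V q) hV hX
    (fun q => ((Finset.univ.filter fun i => c i = q).card : k)
      - (Finset.univ.filter fun i => d i = q).card) (fun x hx => ?_) q
  simp_rw [sub_mul, Finset.sum_sub_distrib]
  rw [← hp c, ← hp d, ← actTrace_congr eM, ← actTrace_congr eN, h x hx, sub_self]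

end BrauerNesbitt

open Polynomial Module in
theorem lsmul_aeval' {k : Type*} [Field k] {M : Type*} [AddCommGroup M] [Module k M]
    (f : Module.End k M) (p : k[X]) :
    Algebra.lsmul k k (AEval' f) p = (AEval'.of f).conj (aeval f p) := by
  ext x
  obtain ⟨x, rfl⟩ := (AEval'.of f).surjective x
  rw [LinearEquiv.conj_apply_apply, LinearEquiv.symm_apply_apply]
  exact (Module.AEval.of_aeval_smul f p x).symm

open Polynomial Module in
/-- Over an algebraically closed field of characteristic zero, the traces of the powers of an
operator of finite order determine its characteristic polynomial. -/
theorem charpoly_eq_of_trace_pow_eq {k : Type*} [Field k] [IsAlgClosed k] [CharZero k]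
    {M : Type*} [AddCommGroup M] [Module k M] [FiniteDimensional k M]
    {N : Type*} [AddCommGroup N] [Module k N] [FiniteDimensional k N]
    (f : Module.End k M) (g : Module.End k N) {n : ℕ} (hn : n ≠ 0) (hf : f ^ n = 1)
    (hg : g ^ n = 1) (h : ∀ i : ℕ, LinearMap.trace k M (f ^ i) = LinearMap.trace k N (g ^ i)) :
    f.charpoly = g.charpoly := by
  have hsq : Squarefree (X ^ n - 1 : k[X]) :=
    (Polynomial.X_pow_sub_one_separable_iff.2 (Nat.cast_ne_zero.2 hn)).squarefree
  -- `f` and `g` make their spaces semisimple `k[X]`-modules, with traces determined on monomials.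
  have : IsSemisimpleModule k[X] (AEval' f) :=
    Module.End.isSemisimple_of_squarefree_aeval_eq_zero hsq (by simp [hf])
  have : IsSemisimpleModule k[X] (AEval' g) :=
    Module.End.isSemisimple_of_squarefree_aeval_eq_zero hsq (by simp [hg])
  have hX : Submodule.span k (Set.range fun i : ℕ => (X ^ i : k[X])) = ⊤ := by
    have := (Polynomial.basisMonomials k).span_eq
    rwa [Polynomial.coe_basisMonomials, funext (fun i => (X_pow_eq_monomial i).symm)] at this
  have : FiniteDimensional k (AEval' f) := Module.Finite.equiv (AEval'.of f)
  have : FiniteDimensional k (AEval' g) := Module.Finite.equiv (AEval'.of g)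
  have ⟨e⟩ := nonempty_linearEquiv_of_actTrace_eq (M := AEval' f) (N := AEval' g) hX (by
    rintro _ ⟨i, rfl⟩
    simp only [actTrace, LinearMap.comp_apply, AlgHom.toLinearMap_apply]
    rw [lsmul_aeval', lsmul_aeval', LinearMap.trace_conj', LinearMap.trace_conj']
    simpa using h i)
  have := actCharpoly_congr (k := k) e X
  rw [actCharpoly, actCharpoly, lsmul_aeval', lsmul_aeval', LinearEquiv.charpoly_conj,
    LinearEquiv.charpoly_conj] at this
  simpa using this

/-! ### Semisimplifications -/

theorem actCharpoly_eq_of_isSemisimplification {k R : Type*} [Field k] [Ring R] [Algebra k R]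
    {M : Type*} [AddCommGroup M] [Module k M] [Module R M] [IsScalarTower k R M]
    [FiniteDimensional k M] {S : Type*} [AddCommGroup S] [Module k S] [Module R S]
    [IsScalarTower k R S] [FiniteDimensional k S] (h : IsSemisimplification R M S) (r : R) :
    actCharpoly k M r = actCharpoly k S r := by
  obtain ⟨-, n, c, hc, h0, hn, ⟨e⟩⟩ := h
  rw [actCharpoly_congr e, actCharpoly_pi_fin
    (fun i : Fin n => (c i.succ) ⧸ (c i.castSucc).submoduleOf (c i.succ))]
  have hstep : ∀ i : Fin n, actCharpoly k (c i.succ) r = actCharpoly k (c i.castSucc) r *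
      actCharpoly k ((c i.succ) ⧸ (c i.castSucc).submoduleOf (c i.succ)) r := by
    intro i
    rw [actCharpoly_submodule_mul_quotient ((c i.castSucc).submoduleOf (c i.succ)),
      actCharpoly_congr (Submodule.submoduleOfEquivOfLe (hc i.castSucc_le_succ))]
  have key : ∀ (n : ℕ) (f : Fin (n + 1) → Polynomial k) (g : Fin n → Polynomial k),
      (∀ i, f i.succ = f i.castSucc * g i) → f (Fin.last n) = f 0 * ∏ i, g i := by
    intro n
    induction n with
    | zero => intro f g _; simp
    | succ n ih =>
      intro f g h
      rw [Fin.prod_univ_castSucc, ← mul_assoc, ← Fin.succ_last, h]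
      congr 1
      exact ih (fun i => f i.castSucc) (fun i => g i.castSucc) fun i => h i.castSucc
  have h1 := key n (fun i => actCharpoly k (c i) r) _ hstep
  have h2 : actCharpoly k (c 0) r = 1 := by
    rw [h0, actCharpoly,
      ← LinearMap.charpoly_toMatrix _ (Module.Basis.empty (ι := Empty) (⊥ : Submodule R M))]
    exact Matrix.charpoly_isEmpty
  rw [h2, one_mul, hn, actCharpoly_congr Submodule.topEquiv] at h1
  exact h1

theorem Representation.lsmul_asModule {k G V : Type*} [Field k] [Group G] [AddCommGroup V]
    [Module k V] (σ : Representation k G V) (g : G) :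
    Algebra.lsmul k k σ.asModule (MonoidAlgebra.of k G g) = σ.asModuleEquiv.symm.conj (σ g) := by
  ext x
  obtain ⟨x, rfl⟩ := σ.asModuleEquiv.symm.surjective x
  rw [LinearEquiv.conj_apply_apply, LinearEquiv.symm_symm, LinearEquiv.apply_symm_apply]
  exact (σ.asModuleEquiv_symm_map_rho g x).symm

theorem Representation.actCharpoly_asModule {k G V : Type*} [Field k] [Group G] [AddCommGroup V]
    [Module k V] [FiniteDimensional k V] (σ : Representation k G V) (g : G) :
    actCharpoly k σ.asModule (MonoidAlgebra.of k G g) = (σ g).charpoly := by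
  rw [actCharpoly, σ.lsmul_asModule, LinearEquiv.charpoly_conj]

theorem MonoidAlgebra.span_range_of (k G : Type*) [Field k] [Group G] :
    Submodule.span k (Set.range (MonoidAlgebra.of k G)) = ⊤ :=
  top_unique fun x _ => Submodule.span_mono (Set.image_subset_range _ _)
    (MonoidAlgebra.mem_span_support_coeff x)

theorem IsSemisimplification.congr {R M S S' : Type*} [Ring R] [AddCommGroup M] [Module R M]
    [AddCommGroup S] [Module R S] [AddCommGroup S'] [Module R S'] (e : S' ≃ₗ[R] S)
    (h : IsSemisimplification R M S) : IsSemisimplification R M S' := by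
  obtain ⟨hs, n, c, h1, h2, h3, ⟨f⟩⟩ := h
  exact ⟨.congr e, n, c, h1, h2, h3, ⟨e.trans f⟩⟩

/-- A composition series gives a semisimplification. -/
theorem exists_isSemisimplification {R : Type*} (M : Type*) [Ring R] [AddCommGroup M] [Module R M]
    [IsNoetherian R M] [IsArtinian R M] :
    ∃ (n : ℕ) (c : Fin (n + 1) → Submodule R M), IsSemisimplification R M
      ((i : Fin n) → (c i.succ) ⧸ (c i.castSucc).submoduleOf (c i.succ)) := by
  obtain ⟨s, h0, hn⟩ := exists_compositionSeries_of_isNoetherian_isArtinian R M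
  have hs : ∀ i : Fin s.length, IsSimpleModule R
      ((s i.succ) ⧸ (s i.castSucc).submoduleOf (s i.succ)) := fun i =>
    (covBy_iff_quot_is_simple (s.strictMono.monotone i.castSucc_le_succ)).1 (s.step i)
  exact ⟨s.length, s, inferInstance, s.length, s, s.strictMono.monotone, h0, hn, ⟨.refl _ _⟩⟩

/-- Every finite-dimensional module over a group algebra is given by a representation on a space
of column vectors. -/
theorem exists_rep_linearEquiv {k G : Type*} [Field k] [Group G] (S : Type*) [AddCommGroup S]
    [Module k S] [Module (MonoidAlgebra k G) S] [IsScalarTower k (MonoidAlgebra k G) S]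
    [FiniteDimensional k S] :
    ∃ (n : ℕ) (σ : Representation k G (Fin n → k)),
      Nonempty (σ.asModule ≃ₗ[MonoidAlgebra k G] S) := by
  let e : S ≃ₗ[k] (Fin (Module.finrank k S) → k) := (Module.finBasis k S).equivFun
  let σ : Representation k G (Fin (Module.finrank k S) → k) :=
    (e.conjAlgEquiv k).toMonoidHom.comp
      ((Algebra.lsmul k k S).toMonoidHom.comp (MonoidAlgebra.of k G))
  refine ⟨_, σ, ⟨{ (σ.asModuleEquiv.trans e.symm) with map_smul' := fun r x => ?_ }⟩⟩
  change e.symm (σ.asModuleEquiv (r • x)) = r • e.symm (σ.asModuleEquiv x)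
  have h : σ.asAlgebraHom.toLinearMap =
      ((e.conjAlgEquiv k).toAlgHom.comp (Algebra.lsmul k k S)).toLinearMap := by
    refine LinearMap.ext_on_range (MonoidAlgebra.span_range_of k G) fun g => ?_
    rw [AlgHom.toLinearMap_apply, Representation.asAlgebraHom_of]
    rfl
  have h1 := LinearMap.congr_fun h r
  simp only [AlgHom.toLinearMap_apply] at h1
  rw [σ.asModuleEquiv_map_smul, h1]
  simp

theorem exists_rep_isSemisimplification {k G V : Type*} [Field k] [Group G] [AddCommGroup V]
    [Module k V] [FiniteDimensional k V] (σ : Representation k G V) :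
    ∃ S : Σ n : ℕ, Representation k G (Fin n → k),
      IsSemisimplification (MonoidAlgebra k G) σ.asModule S.2.asModule := by
  have : IsNoetherian (MonoidAlgebra k G) σ.asModule := isNoetherian_of_tower k inferInstance
  have : IsArtinian (MonoidAlgebra k G) σ.asModule := isArtinian_of_tower k inferInstance
  obtain ⟨n, c, h⟩ := exists_isSemisimplification (R := MonoidAlgebra k G) σ.asModule
  obtain ⟨d, S, ⟨e⟩⟩ := exists_rep_linearEquiv (k := k) (G := G)
    ((i : Fin n) → (c i.succ) ⧸ (c i.castSucc).submoduleOf (c i.succ))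
  exact ⟨⟨d, S⟩, h.congr e⟩

/-! ### Lattices and their reduction -/

section Lattice

variable {ℓ : ℕ} [Fact ℓ.Prime]

instance : ValuationRing (Zbar ℓ) where
  cond' a b := by
    have key : ∀ a b : Zbar ℓ, ‖(a : PadicAlgCl ℓ)‖ ≤ ‖(b : PadicAlgCl ℓ)‖ → ∃ c, b * c = a := by
      intro a b h
      rcases eq_or_ne (b : PadicAlgCl ℓ) 0 with hb | hb
      · rw [hb, norm_zero, norm_le_zero_iff] at h
        exact ⟨0, Subtype.ext (by simp [h])⟩
      · refine ⟨⟨a / b, ?_⟩, Subtype.ext (mul_div_cancel₀ _ hb)⟩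
        rw [mem_Zbar_iff, norm_div]
        exact div_le_one_of_le₀ h (norm_nonneg _)
    rcases le_total ‖(a : PadicAlgCl ℓ)‖ ‖(b : PadicAlgCl ℓ)‖ with h | h
    · obtain ⟨c, hc⟩ := key a b h
      exact ⟨c, Or.inr hc⟩
    · obtain ⟨c, hc⟩ := key b a h
      exact ⟨c, Or.inl hc⟩

instance : IsFractionRing (Zbar ℓ) (PadicAlgCl ℓ) := by
  have : Algebra.IsAlgebraic ℤ_[ℓ] (PadicAlgCl ℓ) :=
    (IsFractionRing.comap_isAlgebraic_iff (A := ℤ_[ℓ]) (K := ℚ_[ℓ])).2 inferInstance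
  exact integralClosure.isFractionRing_of_algebraic (A := ℤ_[ℓ]) (L := PadicAlgCl ℓ)
    ((injective_iff_map_eq_zero _).1 <| by
      rw [IsScalarTower.algebraMap_eq ℤ_[ℓ] ℚ_[ℓ] (PadicAlgCl ℓ)]
      exact (algebraMap ℚ_[ℓ] (PadicAlgCl ℓ)).injective.comp (IsFractionRing.injective _ _))

theorem natCast_mem_maximalIdeal_Zbar : (ℓ : Zbar ℓ) ∈ IsLocalRing.maximalIdeal (Zbar ℓ) := by
  rw [IsLocalRing.mem_maximalIdeal, mem_nonunits_iff]
  intro h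
  obtain ⟨u, hu⟩ := h.exists_right_inv
  have h1 : (ℓ : PadicAlgCl ℓ) * u = 1 := by simpa using congrArg Subtype.val hu
  have h2 := congrArg norm h1
  have h3 := (mem_Zbar_iff ℓ u).1 u.2
  have h4 : ‖(ℓ : PadicAlgCl ℓ)‖ < 1 := by
    have : ((ℓ : ℚ_[ℓ]) : PadicAlgCl ℓ) = ℓ := map_natCast (algebraMap ℚ_[ℓ] (PadicAlgCl ℓ)) ℓ
    rw [← this, PadicAlgCl.norm_extends]
    exact Padic.norm_p_lt_one
  rw [norm_mul, norm_one] at h2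
  nlinarith [norm_nonneg (u : PadicAlgCl ℓ), norm_nonneg (ℓ : PadicAlgCl ℓ)]

instance : CharP (ResBar ℓ) ℓ := by
  have h : ((ℓ : ℕ) : ResBar ℓ) = 0 := by
    rw [← map_natCast (IsLocalRing.residue (Zbar ℓ)), IsLocalRing.residue_eq_zero_iff]
    exact natCast_mem_maximalIdeal_Zbar
  exact ringChar.of_eq (CharP.ringChar_of_prime_eq_zero Fact.out h)

-- A root of a monic lift of `p` is integral, and its reduction is a root of `p`.
instance : IsAlgClosed (ResBar ℓ) := by
  refine IsAlgClosed.of_exists_root _ fun p hp hirr => ?_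
  obtain ⟨q, hq, hdeg, hm⟩ := Polynomial.lifts_and_degree_eq_and_monic
    (Polynomial.map_surjective _ IsLocalRing.residue_surjective p :
      p ∈ Polynomial.lifts (IsLocalRing.residue (Zbar ℓ))) hp
  obtain ⟨x, hx⟩ := IsAlgClosed.exists_aeval_eq_zero (PadicAlgCl ℓ) q (by
    rw [hdeg]
    exact hirr.degree_pos.ne')
  have hxi : IsIntegral ℤ_[ℓ] x := isIntegral_trans (A := Zbar ℓ) x ⟨q, hm, hx⟩
  refine ⟨IsLocalRing.residue _ ⟨x, hxi⟩, ?_⟩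
  rw [← hq, Polynomial.eval_map, Polynomial.eval₂_hom]
  have : q.eval ⟨x, hxi⟩ = 0 := Subtype.ext
    ((Polynomial.hom_eval₂ q (RingHom.id _) (algebraMap (Zbar ℓ) (PadicAlgCl ℓ)) ⟨x, hxi⟩).trans hx)
  rw [this, map_zero]

variable {G V : Type*} [Group G] [AddCommGroup V] [Module (PadicAlgCl ℓ) V]
  {σ : Representation (PadicAlgCl ℓ) G V} {L : Submodule (Zbar ℓ) V}

/-- Finitely generated submodules of a vector space are free over `Zbar`, which is not Noetherian
but is a valuation ring: torsion-free modules over it are flat, and finite flat modules over a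
local ring are free. -/
theorem Submodule.FG.free_of_Zbar (hL : L.FG) : Module.Free (Zbar ℓ) L := by
  have : Module.Finite (Zbar ℓ) L := Module.Finite.iff_fg.2 hL
  have : Module.IsTorsionFree (Zbar ℓ) V :=
    Module.IsTorsionFree.trans_faithfulSMul (Zbar ℓ) (PadicAlgCl ℓ) V
  have : Module.Flat (Zbar ℓ) L := by
    rw [Module.Flat.flat_iff_torsion_eq_bot_of_isBezout,
      ← Submodule.isTorsionFree_iff_torsion_eq_bot]
    infer_instance
  exact Module.free_of_flat_of_isLocalRing

/-- A basis of a lattice is a basis of the vector space. -/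
def IsStableLattice.basis (hL : IsStableLattice σ L) {ι : Type*} (b : Module.Basis ι (Zbar ℓ) L) :
    Module.Basis ι (PadicAlgCl ℓ) V :=
  Module.Basis.mk (v := fun i => (b i : V))
    ((LinearIndependent.iff_fractionRing (Zbar ℓ) (PadicAlgCl ℓ)).1
      (b.linearIndependent.map' L.subtype (Submodule.ker_subtype L))) (by
    have h : (L : Set V) ⊆ Submodule.span (PadicAlgCl ℓ) (Set.range fun i => (b i : V)) := by
      intro x hx
      have := congrArg (Submodule.map L.subtype) b.span_eq
      rw [Submodule.map_span, Submodule.map_top, Submodule.range_subtype, ← Set.range_comp] at this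
      rw [← this] at hx
      exact Submodule.span_subset_span (Zbar ℓ) (PadicAlgCl ℓ) _ hx
    rw [← hL.span_eq_top]
    exact Submodule.span_le.2 h)

theorem IsStableLattice.charpoly_map [FiniteDimensional (PadicAlgCl ℓ) V]
    (hL : IsStableLattice σ L) [Module.Free (Zbar ℓ) L] [Module.Finite (Zbar ℓ) L] (g : G) :
    ((latticeRep σ hL g).charpoly).map (algebraMap (Zbar ℓ) (PadicAlgCl ℓ)) = (σ g).charpoly := by
  classical
  let b := Module.Free.chooseBasis (Zbar ℓ) L
  rw [← LinearMap.charpoly_toMatrix _ b, ← LinearMap.charpoly_toMatrix (σ g) (hL.basis b),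
    ← Matrix.charpoly_map]
  congr 1
  apply (LinearMap.toMatrix (hL.basis b) (hL.basis b)).symm.injective
  rw [LinearMap.toMatrix_symm, Matrix.toLin_toMatrix]
  refine (hL.basis b).ext fun j => ?_
  rw [Matrix.toLin_self]
  have h := congrArg L.subtype
    (Matrix.toLin_self b b (LinearMap.toMatrix b b (latticeRep σ hL g)) j)
  rw [Matrix.toLin_toMatrix, map_sum] at h
  simp only [IsStableLattice.basis, Module.Basis.coe_mk]
  refine Eq.trans ?_ h.symm
  refine Finset.sum_congr rfl fun i _ => ?_
  rw [map_smul]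
  rfl

end Lattice

section Reduction

variable {R G L : Type*} [CommRing R] [IsLocalRing R] [Group G] [AddCommGroup L] [Module R L]

open TensorProduct

/-- The reduction `L / 𝔪 L` is the base change of `L` to the residue field. -/
def residueTensorEquiv :
    IsLocalRing.ResidueField R ⊗[R] L ≃ₗ[IsLocalRing.ResidueField R] ModMax R L :=
  let e : IsLocalRing.ResidueField R ⊗[R] L ≃ₗ[R] ModMax R L :=
    TensorProduct.quotTensorEquivQuotSMul L (IsLocalRing.maximalIdeal R)
  e.extendScalarsOfSurjective IsLocalRing.residue_surjective

theorem residueTensorEquiv_tmul (a : R) (y : L) :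
    residueTensorEquiv (IsLocalRing.residue R a ⊗ₜ[R] y) =
      Submodule.mkQ (IsLocalRing.maximalIdeal R • (⊤ : Submodule R L)) (a • y) :=
  TensorProduct.quotTensorEquivQuotSMul_mk_tmul _ a y

instance [Module.Finite R L] : Module.Finite (IsLocalRing.ResidueField R) (ModMax R L) :=
  Module.Finite.equiv residueTensorEquiv

theorem reductionRep_charpoly [Module.Free R L] [Module.Finite R L] (σ : Representation R G L)
    (g : G) : (reductionRep σ g).charpoly = (σ g).charpoly.map (IsLocalRing.residue R) := by
  have : reductionRep σ g =
      residueTensorEquiv.conj ((σ g).baseChange (IsLocalRing.ResidueField R)) := by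
    refine LinearMap.ext fun x => ?_
    obtain ⟨x, rfl⟩ := residueTensorEquiv.surjective x
    rw [LinearEquiv.conj_apply_apply, LinearEquiv.symm_apply_apply]
    induction x with
    | zero => simp
    | add x y hx hy => simp only [map_add, hx, hy]
    | tmul a y =>
      obtain ⟨a, rfl⟩ := IsLocalRing.residue_surjective a
      rw [LinearMap.baseChange_tmul, residueTensorEquiv_tmul, residueTensorEquiv_tmul, ← map_smul]
      rfl
  rw [this, LinearEquiv.charpoly_conj, LinearMap.charpoly_baseChange]
  rfl

end Reduction

/-! ### Congruence in terms of characteristic polynomials and traces -/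

/-- In characteristic `ℓ`, the characteristic polynomial of `M ^ (ℓ ^ a)` determines that of `M`, as
`(X - M) ^ (ℓ ^ a) = X ^ (ℓ ^ a) - M ^ (ℓ ^ a)`. -/
theorem Matrix.expand_charpoly_pow_char_pow {k n : Type*} [Field k] [Fintype n] [DecidableEq n]
    (ℓ : ℕ) [Fact ℓ.Prime] [CharP k ℓ] (a : ℕ) (M : Matrix n n k) :
    Polynomial.expand k (ℓ ^ a) (M ^ ℓ ^ a).charpoly = M.charpoly ^ ℓ ^ a := by
  cases isEmpty_or_nonempty n
  · simp [Matrix.charpoly_isEmpty]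
  unfold Matrix.charpoly
  rw [AlgHom.map_det, ← Matrix.det_pow]
  refine congrArg Matrix.det (matPolyEquiv.injective ?_)
  rw [map_pow, matPolyEquiv_charmatrix, sub_pow_char_pow_of_commute, ← Polynomial.C_pow]
  · exact matPolyEquiv_eq_X_pow_sub_C (ℓ ^ a) M
  · exact (Polynomial.C M).commute_X

theorem LinearMap.expand_charpoly_pow_char_pow {k V : Type*} [Field k] [AddCommGroup V]
    [Module k V] [FiniteDimensional k V] (ℓ : ℕ) [Fact ℓ.Prime] [CharP k ℓ] (a : ℕ)
    (f : Module.End k V) :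
    Polynomial.expand k (ℓ ^ a) (f ^ ℓ ^ a).charpoly = f.charpoly ^ ℓ ^ a := by
  classical
  let b := Module.finBasis k V
  rw [← LinearMap.charpoly_toMatrix f b, ← LinearMap.charpoly_toMatrix _ b,
    ← LinearMap.toMatrix_pow, Matrix.expand_charpoly_pow_char_pow]

section

variable {ℓ : ℕ} [Fact ℓ.Prime]

theorem Representation.isOfFinOrder_of_finite_range {k G V : Type*} [Field k] [Group G]
    [AddCommGroup V] [Module k V] (σ : Representation k G V) (h : (Set.range σ).Finite) (g : G) :
    IsOfFinOrder (σ g) := by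
  obtain ⟨i, j, hij, h⟩ := h.exists_lt_map_eq_of_forall_mem (f := fun i : ℕ => σ (g ^ i))
    fun i => Set.mem_range_self (g ^ i)
  refine isOfFinOrder_iff_pow_eq_one.2 ⟨j - i, Nat.sub_pos_of_lt hij, ?_⟩
  rw [← map_pow, ← inv_mul_cancel_left (g ^ i) (g ^ (j - i)), ← pow_add,
    Nat.add_sub_cancel' hij.le, map_mul, ← h, ← map_mul, inv_mul_cancel, map_one]

/-- Roots of unity of order prime to `ℓ` are determined by their reductions: if `z ^ n = 1` and
`z ≠ 1`, then `1 + z + ⋯ + z ^ (n - 1) = 0`, whereas this sum reduces to `n` if `z` reduces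
to `1`. -/
theorem eq_of_residue_eq_of_pow_eq_one {n : ℕ} (hn : n.Coprime ℓ) {x y : Zbar ℓ} (hx : x ^ n = 1)
    (hy : y ^ n = 1) (h : IsLocalRing.residue _ x = IsLocalRing.residue _ y) : x = y := by
  obtain ⟨m, rfl⟩ : ∃ m, n = m + 1 := Nat.exists_eq_succ_of_ne_zero (by
    rintro rfl
    exact (Fact.out : ℓ.Prime).one_lt.ne' (by simpa using hn))
  have hu : (x * y ^ m) ^ (m + 1) = 1 := by
    rw [mul_pow, hx, one_mul, ← pow_mul, mul_comm, pow_mul, hy, one_pow]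
  have hr : IsLocalRing.residue _ (x * y ^ m) = 1 := by
    rw [map_mul, h, map_pow, ← pow_succ', ← map_pow, hy, map_one]
  suffices x * y ^ m = 1 by
    calc x = x * y ^ (m + 1) := by rw [hy, mul_one]
      _ = (x * y ^ m) * y := by ring
      _ = y := by rw [this, one_mul]
  by_contra hne
  have h1 : (∑ i ∈ Finset.range (m + 1), (x * y ^ m) ^ i) * (x * y ^ m - 1) = 0 := by
    rw [geom_sum_mul, hu, sub_self]
  have h2 := congrArg (IsLocalRing.residue _)
    ((mul_eq_zero.1 h1).resolve_right (sub_ne_zero.2 hne))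
  simp only [map_sum, map_pow _ (x * y ^ m), hr, one_pow, Finset.sum_const, Finset.card_range,
    nsmul_eq_mul, mul_one, map_zero] at h2
  have h3 := (CharP.cast_eq_zero_iff (ResBar ℓ) ℓ (m + 1)).1 h2
  exact (Fact.out : ℓ.Prime).one_lt.ne' (Nat.eq_one_of_dvd_coprimes hn h3 dvd_rfl)

theorem pow_eq_one_of_isRoot_charpoly {k V : Type*} [Field k] [AddCommGroup V] [Module k V]
    [FiniteDimensional k V] {f : Module.End k V} {n : ℕ} (hf : f ^ n = 1) {r : k}
    (hr : f.charpoly.IsRoot r) : r ^ n = 1 := by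
  obtain ⟨v, hv⟩ := ((Module.End.hasEigenvalue_iff_isRoot_charpoly f r).2 hr).exists_hasEigenvector
  have h := hv.pow_apply n
  rw [hf, Module.End.one_apply] at h
  exact sub_eq_zero.1 ((smul_eq_zero.1 (by rw [sub_smul, one_smul, ← h, sub_self] :
    (r ^ n - 1) • v = 0)).resolve_right hv.2)

/-- A monic polynomial over `Zbar` all of whose roots are roots of unity of order prime to `ℓ` is
determined by its reduction. -/
theorem eq_of_map_residue_eq {n : ℕ} (hn : n.Coprime ℓ) {a b : Polynomial (Zbar ℓ)} (ha : a.Monic)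
    (hb : b.Monic)
    (ha' : ∀ r, (a.map (algebraMap (Zbar ℓ) (PadicAlgCl ℓ))).IsRoot r → r ^ n = 1)
    (hb' : ∀ r, (b.map (algebraMap (Zbar ℓ) (PadicAlgCl ℓ))).IsRoot r → r ^ n = 1)
    (h : a.map (IsLocalRing.residue _) = b.map (IsLocalRing.residue _)) : a = b := by
  have hn0 : n ≠ 0 := by
    rintro rfl
    exact (Fact.out : ℓ.Prime).one_lt.ne' (by simpa using hn)
  have key : ∀ a : Polynomial (Zbar ℓ), a.Monic →
      (∀ r, (a.map (algebraMap (Zbar ℓ) (PadicAlgCl ℓ))).IsRoot r → r ^ n = 1) →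
      ∃ s : Multiset (Zbar ℓ), (∀ x ∈ s, x ^ n = 1) ∧
        a = (s.map fun x => Polynomial.X - Polynomial.C x).prod := by
    intro a ha ha'
    have hA := ha.map (algebraMap (Zbar ℓ) (PadicAlgCl ℓ))
    have hr : ∀ r ∈ (a.map (algebraMap (Zbar ℓ) (PadicAlgCl ℓ))).roots, r ^ n = 1 := fun r hr =>
      ha' r (Polynomial.isRoot_of_mem_roots hr)
    obtain ⟨s, hs⟩ : ∃ s : Multiset (Zbar ℓ), s.map (algebraMap (Zbar ℓ) (PadicAlgCl ℓ)) =
        (a.map (algebraMap (Zbar ℓ) (PadicAlgCl ℓ))).roots := by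
      refine ⟨Multiset.pmap (fun r hr => ⟨r, hr⟩) _ fun r h => (mem_integralClosure_iff _ _).2
        (IsIntegral.of_pow (Nat.pos_of_ne_zero hn0) (by rw [hr r h]; exact isIntegral_one)), ?_⟩
      rw [Multiset.map_pmap]
      exact (Multiset.pmap_eq_map _ _ _ _).trans (Multiset.map_id' _)
    refine ⟨s, fun x hx => ?_, ?_⟩
    · refine Subtype.ext (hr x ?_)
      rw [← hs]
      exact Multiset.mem_map_of_mem _ hx
    · refine Polynomial.map_injective _
        (FaithfulSMul.algebraMap_injective (Zbar ℓ) (PadicAlgCl ℓ)) ?_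
      rw [(IsAlgClosed.splits (a.map (algebraMap (Zbar ℓ) (PadicAlgCl ℓ)))).eq_prod_roots_of_monic
        hA, ← hs, Polynomial.map_multiset_prod, Multiset.map_map, Multiset.map_map]
      refine congrArg Multiset.prod (Multiset.map_congr rfl fun x _ => ?_)
      rw [Function.comp_apply, Function.comp_apply, Polynomial.map_sub, Polynomial.map_X,
        Polynomial.map_C]
  obtain ⟨s, hs, rfl⟩ := key a ha ha'
  obtain ⟨t, ht, rfl⟩ := key b hb hb'
  have hst : s.map (IsLocalRing.residue (Zbar ℓ)) = t.map (IsLocalRing.residue _) := by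
    have h1 : ∀ s : Multiset (Zbar ℓ), ((s.map fun x => Polynomial.X - Polynomial.C x).prod.map
        (IsLocalRing.residue _)).roots = s.map (IsLocalRing.residue _) := by
      intro s
      rw [Polynomial.map_multiset_prod, Multiset.map_map,
        ← Polynomial.roots_multiset_prod_X_sub_C (s.map (IsLocalRing.residue _)), Multiset.map_map]
      simp
    rw [← h1, h, h1]
  have hg : ∀ s : Multiset (Zbar ℓ), (∀ x ∈ s, x ^ n = 1) →
      (s.map (IsLocalRing.residue (Zbar ℓ))).map
        (Function.invFunOn (IsLocalRing.residue (Zbar ℓ)) {x | x ^ n = 1}) = s := by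
    intro s hs
    rw [Multiset.map_map]
    refine (Multiset.map_congr rfl fun x hx => ?_).trans (Multiset.map_id s)
    have hm : ∃ y ∈ {x : Zbar ℓ | x ^ n = 1}, IsLocalRing.residue _ y = IsLocalRing.residue _ x :=
      ⟨x, hs x hx, rfl⟩
    exact eq_of_residue_eq_of_pow_eq_one hn (Function.invFunOn_mem hm) (hs x hx)
      (Function.invFunOn_eq hm)
  rw [← hg s hs, ← hg t ht, hst]

variable {G V V' : Type*} [Group G] [AddCommGroup V] [Module (PadicAlgCl ℓ) V]
  [FiniteDimensional (PadicAlgCl ℓ) V] [AddCommGroup V'] [Module (PadicAlgCl ℓ) V']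
  [FiniteDimensional (PadicAlgCl ℓ) V']

/-- The translates of a basis under a finite image span a stable lattice. -/
theorem exists_isStableLattice (σ : Representation (PadicAlgCl ℓ) G V)
    (h : (Set.range σ).Finite) : ∃ L, IsStableLattice σ L := by
  let b := Module.finBasis (PadicAlgCl ℓ) V
  let s : Set V := ⋃ f ∈ Set.range σ, Set.range fun i => f (b i)
  have hs : s.Finite := h.biUnion fun _ _ => Set.finite_range _
  refine ⟨Submodule.span _ s, ⟨Submodule.fg_span hs, ?_, fun g v hv => ?_⟩⟩
  · rw [Submodule.span_span_of_tower, ← top_le_iff, ← b.span_eq]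
    refine Submodule.span_mono ?_
    rintro _ ⟨i, rfl⟩
    exact Set.mem_biUnion ⟨1, map_one σ⟩ ⟨i, rfl⟩
  · have : Submodule.span (Zbar ℓ) s ≤
        (Submodule.span (Zbar ℓ) s).comap ((σ g).restrictScalars (Zbar ℓ)) := by
      rw [Submodule.span_le]
      intro x hx
      obtain ⟨_, ⟨k, rfl⟩, ⟨i, rfl⟩⟩ := Set.mem_iUnion₂.1 hx
      refine Submodule.subset_span (Set.mem_biUnion ⟨g * k, rfl⟩ ⟨i, ?_⟩)
      simp
    exact this hv

/-- The characteristic polynomial on a member of the reduction class is the reduction of an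
integral model of the characteristic polynomial. -/
theorem exists_charpoly_of_mem_reductionClass {σ : Representation (PadicAlgCl ℓ) G V}
    {S : Σ n : ℕ, Representation (ResBar ℓ) G (Fin n → ResBar ℓ)} (hS : S ∈ reductionClass σ)
    (g : G) : ∃ a : Polynomial (Zbar ℓ), a.Monic ∧
      a.map (algebraMap (Zbar ℓ) (PadicAlgCl ℓ)) = (σ g).charpoly ∧
      a.map (IsLocalRing.residue _) = (S.2 g).charpoly := by
  obtain ⟨L, hL, h⟩ := hS
  have := hL.fg.free_of_Zbar
  have : Module.Finite (Zbar ℓ) L := Module.Finite.iff_fg.2 hL.fg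
  refine ⟨(latticeRep σ hL g).charpoly, LinearMap.charpoly_monic _, hL.charpoly_map g, ?_⟩
  rw [← reductionRep_charpoly, ← Representation.actCharpoly_asModule,
    ← Representation.actCharpoly_asModule]
  exact actCharpoly_eq_of_isSemisimplification h _

omit [FiniteDimensional (PadicAlgCl ℓ) V] in
theorem reductionClass_nonempty {σ : Representation (PadicAlgCl ℓ) G V}
    (h : ∃ L, IsStableLattice σ L) :
    (reductionClass σ).Nonempty := by
  obtain ⟨L, hL⟩ := h
  have : Module.Finite (Zbar ℓ) L := Module.Finite.iff_fg.2 hL.fg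
  obtain ⟨S, hS⟩ := exists_rep_isSemisimplification (reductionRep (latticeRep σ hL))
  exact ⟨S, L, hL, hS⟩

/-- Congruence modulo `ℓ` means that characteristic polynomials have the same reduction. -/
theorem congruentMod_iff_charpoly {σ₁ : Representation (PadicAlgCl ℓ) G V}
    {σ₂ : Representation (PadicAlgCl ℓ) G V'} (h₁ : ∃ L, IsStableLattice σ₁ L)
    (h₂ : ∃ L, IsStableLattice σ₂ L) :
    CongruentMod σ₁ σ₂ ↔ ∀ g, ∃ a b : Polynomial (Zbar ℓ), a.Monic ∧ b.Monic ∧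
      a.map (algebraMap (Zbar ℓ) (PadicAlgCl ℓ)) = (σ₁ g).charpoly ∧
      b.map (algebraMap (Zbar ℓ) (PadicAlgCl ℓ)) = (σ₂ g).charpoly ∧
      a.map (IsLocalRing.residue _) = b.map (IsLocalRing.residue _) := by
  constructor
  · intro h g
    obtain ⟨S, hS⟩ := reductionClass_nonempty h₁
    obtain ⟨a, ha, ha1, ha2⟩ := exists_charpoly_of_mem_reductionClass hS g
    rw [h] at hS
    obtain ⟨b, hb, hb1, hb2⟩ := exists_charpoly_of_mem_reductionClass hS g
    exact ⟨a, b, ha, hb, ha1, hb1, ha2.trans hb2.symm⟩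
  · intro h
    have key : ∀ {S T : Σ n : ℕ, Representation (ResBar ℓ) G (Fin n → ResBar ℓ)},
        S ∈ reductionClass σ₁ → T ∈ reductionClass σ₂ →
        S ∈ reductionClass σ₂ ∧ T ∈ reductionClass σ₁ := by
      intro S T hS hT
      have heq : ∀ g, (S.2 g).charpoly = (T.2 g).charpoly := by
        intro g
        obtain ⟨a, b, -, -, ha, hb, hab⟩ := h g
        obtain ⟨a', -, ha1, ha2⟩ := exists_charpoly_of_mem_reductionClass hS g
        obtain ⟨b', -, hb1, hb2⟩ := exists_charpoly_of_mem_reductionClass hT g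
        have hinj := Polynomial.map_injective _
          (FaithfulSMul.algebraMap_injective (Zbar ℓ) (PadicAlgCl ℓ))
        rw [← ha2, ← hb2, hinj (ha1.trans ha.symm), hinj (hb1.trans hb.symm), hab]
      obtain ⟨L, hL, hS⟩ := hS
      obtain ⟨L', hL', hT⟩ := hT
      have := hS.1
      have := hT.1
      obtain ⟨e⟩ := nonempty_linearEquiv_of_actCharpoly_eq (M := S.2.asModule) (N := T.2.asModule)
        ℓ (MonoidAlgebra.span_range_of (ResBar ℓ) G) (by
          rintro _ ⟨g, rfl⟩
          rw [Representation.actCharpoly_asModule, Representation.actCharpoly_asModule, heq])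
      exact ⟨⟨L', hL', hT.congr e⟩, ⟨L, hL, hS.congr e.symm⟩⟩
    obtain ⟨S, hS⟩ := reductionClass_nonempty h₁
    obtain ⟨T, hT⟩ := reductionClass_nonempty h₂
    exact Set.ext fun X => ⟨fun hX => (key hX hT).1, fun hX => (key hS hX).2⟩

/-- For representations with finite image, congruence modulo `ℓ` means equality of traces at the
elements which act with order prime to `ℓ`. -/
theorem congruentMod_iff_trace {σ₁ : Representation (PadicAlgCl ℓ) G V}
    {σ₂ : Representation (PadicAlgCl ℓ) G V'} (h₁ : (Set.range σ₁).Finite)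
    (h₂ : (Set.range σ₂).Finite) :
    CongruentMod σ₁ σ₂ ↔ ∀ (g : G) (n : ℕ), n.Coprime ℓ → σ₁ g ^ n = 1 → σ₂ g ^ n = 1 →
      LinearMap.trace _ _ (σ₁ g) = LinearMap.trace _ _ (σ₂ g) := by
  obtain ⟨L₁, hL₁⟩ := exists_isStableLattice σ₁ h₁
  obtain ⟨L₂, hL₂⟩ := exists_isStableLattice σ₂ h₂
  rw [congruentMod_iff_charpoly ⟨L₁, hL₁⟩ ⟨L₂, hL₂⟩]
  constructor
  · intro h g n hn hg1 hg2
    obtain ⟨a, b, ha, hb, ha1, hb1, hab⟩ := h g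
    have heq : a = b := eq_of_map_residue_eq hn ha hb
      (fun r hr => pow_eq_one_of_isRoot_charpoly hg1 (ha1 ▸ hr))
      (fun r hr => pow_eq_one_of_isRoot_charpoly hg2 (hb1 ▸ hr)) hab
    rw [LinearMap.trace_eq_neg_nextCoeff_charpoly, LinearMap.trace_eq_neg_nextCoeff_charpoly,
      ← ha1, ← hb1, heq]
  · intro h g
    obtain ⟨N₁, hN₁, h1⟩ := isOfFinOrder_iff_pow_eq_one.1 (σ₁.isOfFinOrder_of_finite_range h₁ g)
    obtain ⟨N₂, hN₂, h2⟩ := isOfFinOrder_iff_pow_eq_one.1 (σ₂.isOfFinOrder_of_finite_range h₂ g)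
    -- With `ℓ ^ a * n` a common multiple of the orders of `σ₁ g` and `σ₂ g`, the element
    -- `g ^ ℓ ^ a` acts with order dividing `n`, which is prime to `ℓ`.
    obtain ⟨a, n, hn, hN⟩ := Nat.exists_eq_pow_mul_and_not_dvd (mul_pos hN₁ hN₂).ne' ℓ
      (Fact.out : ℓ.Prime).ne_one
    have hn' : n.Coprime ℓ := ((Nat.Prime.coprime_iff_not_dvd Fact.out).2 hn).symm
    have hg1 : σ₁ (g ^ ℓ ^ a) ^ n = 1 := by
      rw [map_pow, ← pow_mul, ← hN, pow_mul, h1, one_pow]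
    have hg2 : σ₂ (g ^ ℓ ^ a) ^ n = 1 := by
      rw [map_pow, ← pow_mul, ← hN, mul_comm, pow_mul, h2, one_pow]
    have hn0 : n ≠ 0 := fun h0 => hn (h0 ▸ dvd_zero _)
    have hc := charpoly_eq_of_trace_pow_eq _ _ hn0 hg1 hg2 (fun i => by
      rw [← map_pow, ← map_pow]
      refine h _ n hn' ?_ ?_
      · rw [map_pow, ← pow_mul, mul_comm, pow_mul, hg1, one_pow]
      · rw [map_pow, ← pow_mul, mul_comm, pow_mul, hg2, one_pow])
    have := hL₁.fg.free_of_Zbar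
    have : Module.Finite (Zbar ℓ) L₁ := Module.Finite.iff_fg.2 hL₁.fg
    have := hL₂.fg.free_of_Zbar
    have : Module.Finite (Zbar ℓ) L₂ := Module.Finite.iff_fg.2 hL₂.fg
    refine ⟨(latticeRep σ₁ hL₁ g).charpoly, (latticeRep σ₂ hL₂ g).charpoly,
      LinearMap.charpoly_monic _, LinearMap.charpoly_monic _, hL₁.charpoly_map g,
      hL₂.charpoly_map g, ?_⟩
    rw [← hL₁.charpoly_map, ← hL₂.charpoly_map] at hc
    have hc' := congrArg (Polynomial.map (IsLocalRing.residue _)) (Polynomial.map_injective _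
      (FaithfulSMul.algebraMap_injective (Zbar ℓ) (PadicAlgCl ℓ)) hc)
    rw [← reductionRep_charpoly, ← reductionRep_charpoly] at hc' ⊢
    rw [map_pow, map_pow] at hc'
    have hc2 := congrArg (Polynomial.expand _ (ℓ ^ a)) hc'
    rw [LinearMap.expand_charpoly_pow_char_pow, LinearMap.expand_charpoly_pow_char_pow] at hc2
    exact iterateFrobenius_inj (Polynomial (ResBar ℓ)) ℓ a hc2

end

/-! ### The trace of an induced representation -/

theorem LinearMap.trace_pi_eq_sum {k ι V : Type*} [Field k] [Fintype ι] [DecidableEq ι]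
    [AddCommGroup V] [Module k V] [FiniteDimensional k V] (A : (ι → V) →ₗ[k] (ι → V)) :
    LinearMap.trace k _ A =
      ∑ i, LinearMap.trace k V (LinearMap.proj i ∘ₗ A ∘ₗ LinearMap.single k (fun _ => V) i) := by
  have h : A = ∑ i, LinearMap.single k (fun _ => V) i ∘ₗ (LinearMap.proj i ∘ₗ A) := by
    refine LinearMap.ext fun x => ?_
    simp only [LinearMap.sum_apply, LinearMap.comp_apply, LinearMap.proj_apply,
      LinearMap.single_apply]
    exact (Finset.univ_sum_single (A x)).symm
  conv_lhs => rw [h, map_sum]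
  refine Finset.sum_congr rfl fun i _ => ?_
  rw [LinearMap.trace_comp_comm', LinearMap.comp_assoc]

section Coind

variable {k G V : Type*} [Field k] [Group G] [AddCommGroup V] [Module k V] {H : Subgroup G}
  (σ : Representation k H V)

theorem mul_out_mem (H : Subgroup G) (g : G) : g * (QuotientGroup.mk g⁻¹ : G ⧸ H).out ∈ H := by
  have := QuotientGroup.eq.1 (QuotientGroup.out_eq' (QuotientGroup.mk g⁻¹ : G ⧸ H)).symm
  rwa [inv_inv] at this

/-- The induced representation is the space of functions on the left cosets `G ⧸ H`: an element
`f` corresponds to its values on the inverses of the chosen representatives (the inverses, as `f` is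
equivariant under `H` on the left). -/
def coindEquiv : Representation.coindV H.subtype σ ≃ₗ[k] (G ⧸ H → V) where
  toFun f c := f.1 c.out⁻¹
  map_add' _ _ := rfl
  map_smul' _ _ := rfl
  invFun v := ⟨fun g => σ ⟨g * (QuotientGroup.mk g⁻¹ : G ⧸ H).out, mul_out_mem H g⟩
      (v (QuotientGroup.mk g⁻¹)), by
    intro h g
    have key : ∀ (d d' : G ⧸ H), d' = d → ∀ (m' : H.subtype h * g * d'.out ∈ H)
        (m : g * d.out ∈ H), σ ⟨_, m'⟩ (v d') = σ h (σ ⟨_, m⟩ (v d)) := by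
      rintro d _ rfl m' m
      rw [← Module.End.mul_apply, ← map_mul]
      congr 2
      exact Subtype.ext (mul_assoc _ _ _)
    exact key _ _ (QuotientGroup.eq.2 (by simp)) _ _⟩
  left_inv f := by
    refine Subtype.ext (funext fun g => ?_)
    have := f.2 ⟨g * (QuotientGroup.mk g⁻¹ : G ⧸ H).out, mul_out_mem H g⟩
      (QuotientGroup.mk g⁻¹ : G ⧸ H).out⁻¹
    simpa using this.symm
  right_inv v := by
    funext c
    have key : ∀ d : G ⧸ H, d = c → ∀ m : c.out⁻¹ * d.out ∈ H, σ ⟨_, m⟩ (v d) = v c := by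
      rintro _ rfl m
      have h1 : (⟨_, m⟩ : H) = 1 := Subtype.ext (inv_mul_cancel _)
      rw [h1, map_one, Module.End.one_apply]
    exact key _ (by rw [inv_inv, QuotientGroup.out_eq']) _

theorem finiteDimensional_coindV [FiniteDimensional k V] [H.FiniteIndex] :
    FiniteDimensional k (Representation.coindV H.subtype σ) := by
  have := Subgroup.finite_quotient_of_finiteIndex (H := H)
  exact Module.Finite.equiv (coindEquiv σ).symm

open Classical in
/-- Frobenius' formula for the trace of an induced representation. -/
theorem trace_coind [FiniteDimensional k V] [Fintype (G ⧸ H)] (w : G) :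
    LinearMap.trace k _ (Representation.coind H.subtype σ w) =
      ∑ c : G ⧸ H, if h : c.out⁻¹ * w * c.out ∈ H then LinearMap.trace k V (σ ⟨_, h⟩) else 0 := by
  rw [← LinearMap.trace_conj' _ (coindEquiv σ), LinearMap.trace_pi_eq_sum]
  refine Finset.sum_congr rfl fun c _ => ?_
  have h0 : ∀ v, (LinearMap.proj c ∘ₗ
      ((coindEquiv σ).conj (Representation.coind H.subtype σ w)) ∘ₗ
        LinearMap.single k (fun _ => V) c) v =
      σ ⟨c.out⁻¹ * w * (QuotientGroup.mk (c.out⁻¹ * w)⁻¹ : G ⧸ H).out, mul_out_mem H _⟩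
        ((Pi.single c v : G ⧸ H → V) (QuotientGroup.mk (c.out⁻¹ * w)⁻¹)) := fun v => rfl
  by_cases h : c.out⁻¹ * w * c.out ∈ H
  · rw [dif_pos h]
    congr 1
    refine LinearMap.ext fun v => ?_
    rw [h0]
    have key : ∀ d : G ⧸ H, d = c → ∀ m : c.out⁻¹ * w * d.out ∈ H,
        σ ⟨_, m⟩ ((Pi.single c v : G ⧸ H → V) d) = σ ⟨_, h⟩ v := by
      rintro _ rfl m
      rw [Pi.single_eq_same]
    refine key _ ?_ _
    rw [← QuotientGroup.out_eq' c, QuotientGroup.eq, inv_inv, QuotientGroup.out_eq']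
    exact h
  · rw [dif_neg h]
    convert LinearMap.map_zero _
    refine LinearMap.ext fun v => ?_
    rw [h0, Pi.single_eq_of_ne, map_zero, LinearMap.zero_apply]
    intro hc
    refine h ?_
    have h1 := hc.trans (QuotientGroup.out_eq' c).symm
    rwa [QuotientGroup.eq, inv_inv] at h1

end Coind

/-! ### Orthogonality of matrix coefficients -/

section Schur

variable {k P V W : Type*} [Field k] [Group P] [AddCommGroup V] [Module k V]
  [FiniteDimensional k V] [AddCommGroup W] [Module k W] [FiniteDimensional k W]

omit [FiniteDimensional k V] [FiniteDimensional k W] [Group P] in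
theorem LinearMap.trace_eq_sum_coord {ι : Type*} [Fintype ι] (b : Module.Basis ι k V)
    (X : Module.End k V) : LinearMap.trace k V X = ∑ i, b.coord i (X (b i)) := by
  classical
  rw [LinearMap.trace_eq_matrix_trace k b, Matrix.trace]
  simp [LinearMap.toMatrix_apply]

omit [FiniteDimensional k V] [FiniteDimensional k W] in
/-- A product of traces is a sum of matrix coefficients of the compositions `X T Y`, where `T` runs
through the matrix units. -/
theorem LinearMap.trace_mul_trace {ι κ : Type*} [Fintype ι] [Fintype κ] (b : Module.Basis ι k V)
    (c : Module.Basis κ k W) (X : Module.End k V) (Y : Module.End k W) :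
    LinearMap.trace k V X * LinearMap.trace k W Y =
      ∑ i, ∑ j, b.coord i ((X ∘ₗ (c.coord j).smulRight (b i) ∘ₗ Y) (c j)) := by
  rw [LinearMap.trace_eq_sum_coord b, LinearMap.trace_eq_sum_coord c, Finset.sum_mul_sum]
  refine Finset.sum_congr rfl fun i _ => Finset.sum_congr rfl fun j _ => ?_
  simp [mul_comm]

variable {K : Subgroup P} {A : Representation k P V} {B : Representation k P W}

omit [FiniteDimensional k V] in
theorem Representation.apply_out_mk (hA : ∀ x ∈ K, A x = 1) (x : P) :
    A (QuotientGroup.mk x : P ⧸ K).out = A x := by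
  have := hA _ (QuotientGroup.eq.1 (QuotientGroup.out_eq' (QuotientGroup.mk x : P ⧸ K)).symm)
  rw [← mul_inv_cancel_left x (QuotientGroup.mk x : P ⧸ K).out, map_mul, this, mul_one]

omit [FiniteDimensional k V] in
theorem Representation.apply_out_mk_inv (hA : ∀ x ∈ K, A x = 1) (x : P) :
    A ((QuotientGroup.mk x : P ⧸ K).out)⁻¹ = A x⁻¹ := by
  have := hA _ (QuotientGroup.eq.1 (QuotientGroup.out_eq' (QuotientGroup.mk x : P ⧸ K)).symm)
  rw [← mul_inv_cancel_right x⁻¹ (QuotientGroup.mk x : P ⧸ K).out, map_mul, this, one_mul]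

variable [K.Normal] [Fintype (P ⧸ K)]

/-- Averaging over a finite quotient of `P` turns a linear map into an intertwining map. -/
def averageIntertwining (hA : ∀ x ∈ K, A x = 1) (hB : ∀ x ∈ K, B x = 1) (T : W →ₗ[k] V) :
    Representation.IntertwiningMap B A where
  toLinearMap := ∑ q : P ⧸ K, A q.out⁻¹ ∘ₗ T ∘ₗ B q.out
  isIntertwining' y := by
    refine LinearMap.ext fun w => ?_
    simp only [LinearMap.comp_apply, LinearMap.sum_apply, map_sum]
    refine Fintype.sum_equiv (Equiv.mulRight (QuotientGroup.mk y : P ⧸ K)) _ _ fun q => ?_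
    have hq : Equiv.mulRight (QuotientGroup.mk y : P ⧸ K) q = QuotientGroup.mk (q.out * y) := by
      rw [QuotientGroup.mk_mul, QuotientGroup.out_eq']
      rfl
    rw [hq, Representation.apply_out_mk hB, Representation.apply_out_mk_inv hA]
    rw [← Module.End.mul_apply (A y), ← map_mul, mul_inv_rev, mul_inv_cancel_left, map_mul B,
      Module.End.mul_apply]

omit [FiniteDimensional k V] [FiniteDimensional k W] in
/-- A sum of products of traces, in terms of averages of the matrix units. -/
theorem sum_trace_mul_trace (hA : ∀ x ∈ K, A x = 1) (hB : ∀ x ∈ K, B x = 1)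
    (Y : Module.End k V) (Z : Module.End k W) {ι κ : Type*} [Fintype ι] [Fintype κ]
    (b : Module.Basis ι k V) (c : Module.Basis κ k W) :
    ∑ q : P ⧸ K, LinearMap.trace k V (Y * A q.out⁻¹) * LinearMap.trace k W (B q.out * Z) =
      ∑ i, ∑ j, b.coord i
        (Y (averageIntertwining hA hB ((c.coord j).smulRight (b i)) (Z (c j)))) := by
  simp_rw [LinearMap.trace_mul_trace b c]
  rw [Finset.sum_comm]
  refine Finset.sum_congr rfl fun i _ => ?_
  rw [Finset.sum_comm]
  refine Finset.sum_congr rfl fun j _ => ?_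
  rw [← Representation.IntertwiningMap.toLinearMap_apply, averageIntertwining,
    LinearMap.sum_apply, map_sum, map_sum]
  rfl

/-- Orthogonality of matrix coefficients of two irreducible representations that are not
isomorphic. -/
theorem sum_trace_mul_trace_eq_zero [A.IsIrreducible] [B.IsIrreducible] (hA : ∀ x ∈ K, A x = 1)
    (hB : ∀ x ∈ K, B x = 1) (h : IsEmpty (B.Equiv A)) (Y : Module.End k V) (Z : Module.End k W) :
    ∑ q : P ⧸ K, LinearMap.trace k V (Y * A q.out⁻¹) * LinearMap.trace k W (B q.out * Z) = 0 := by
  rw [sum_trace_mul_trace hA hB Y Z (Module.finBasis k V) (Module.finBasis k W)]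
  refine Finset.sum_eq_zero fun i _ => Finset.sum_eq_zero fun j _ => ?_
  rw [Subsingleton.elim (averageIntertwining hA hB _) 0]
  simp

/-- Orthogonality of matrix coefficients of an irreducible representation, in the form needed for
cosets: `Y` and `Z` are inverse to each other. -/
theorem sum_trace_mul_trace_eq_card [IsAlgClosed k] [CharZero k] [A.IsIrreducible]
    (hA : ∀ x ∈ K, A x = 1) (Y Z : Module.End k V) (hYZ : Y * Z = 1) :
    ∑ q : P ⧸ K, LinearMap.trace k V (Y * A q.out⁻¹) * LinearMap.trace k V (A q.out * Z) =
      Fintype.card (P ⧸ K) := by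
  have : Nontrivial V := IsSimpleModule.nontrivial (MonoidAlgebra k P) A.asModule
  let b := Module.finBasis k V
  have hd : (Module.finrank k V : k) ≠ 0 := Nat.cast_ne_zero.2 Module.finrank_pos.ne'
  -- By Schur's lemma the average of `T` is a scalar, which is determined by its trace.
  have key : ∀ T : V →ₗ[k] V, (averageIntertwining hA hA T).toLinearMap =
      ((Fintype.card (P ⧸ K) : k) * LinearMap.trace k V T / Module.finrank k V) • 1 := by
    intro T
    obtain ⟨c, hc⟩ :=
      (Representation.IsIrreducible.algebraMap_intertwiningMap_bijective_of_isAlgClosed (k := k)).2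
        (averageIntertwining hA hA T)
    have h1 : (averageIntertwining hA hA T).toLinearMap = c • 1 := by
      rw [← hc]
      rfl
    have h2 := congrArg (LinearMap.trace k V) h1
    have h3 : LinearMap.trace k V (averageIntertwining hA hA T).toLinearMap =
        (Fintype.card (P ⧸ K) : k) * LinearMap.trace k V T := by
      rw [averageIntertwining, map_sum, ← nsmul_eq_mul, ← Finset.card_univ]
      refine Finset.sum_eq_card_nsmul fun q _ => ?_
      rw [LinearMap.trace_comp_comm', LinearMap.comp_assoc, ← Module.End.mul_eq_comp (A _),
        ← map_mul, mul_inv_cancel, map_one]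
      rfl
    rw [h3, map_smul, LinearMap.trace_one, smul_eq_mul] at h2
    rw [h1, h2, mul_div_cancel_right₀ _ hd]
  rw [sum_trace_mul_trace hA hA Y Z b b]
  have h1 : ∀ i j, b.coord i
      (Y (averageIntertwining hA hA ((b.coord j).smulRight (b i)) (Z (b j)))) =
      if i = j then (Fintype.card (P ⧸ K) : k) / Module.finrank k V else 0 := by
    intro i j
    have h2 : Y (Z (b j)) = b j := LinearMap.congr_fun hYZ _
    rw [← Representation.IntertwiningMap.toLinearMap_apply, key, LinearMap.smul_apply,
      Module.End.one_apply, map_smul, h2, LinearMap.trace_smulRight]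
    by_cases hij : i = j
    · subst hij
      simp
    · simp [Finsupp.single_eq_of_ne, hij, Ne.symm hij]
  simp_rw [h1]
  simp only [Finset.sum_ite_eq, Finset.mem_univ, if_true, Finset.sum_const, Finset.card_univ,
    Fintype.card_fin, nsmul_eq_mul]
  exact mul_div_cancel₀ _ hd

end Schur

/-! ### Congruences between induced representations of an abstract group -/

theorem Representation.IsIrreducible.comp_surjective {k G G' V : Type*} [Field k] [Group G]
    [Group G'] [AddCommGroup V] [Module k V] {A : Representation k G V} (hA : A.IsIrreducible)
    (f : G' →* G) (hf : Function.Surjective f) : Representation.IsIrreducible (A.comp f) := by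
  let e : Subrepresentation (A.comp f) ≃o Subrepresentation A :=
    { toFun := fun S => ⟨S.toSubmodule, fun g v hv => by
        obtain ⟨g, rfl⟩ := hf g
        exact S.apply_mem_toSubmodule g hv⟩
      invFun := fun S => ⟨S.toSubmodule, fun g v hv => S.apply_mem_toSubmodule (f g) hv⟩
      left_inv := fun _ => rfl
      right_inv := fun _ => rfl
      map_rel_iff' := Iff.rfl }
  exact (OrderIso.isSimpleOrder_iff e).2 hA

theorem Representation.finiteIndex_ker {k G V : Type*} [Field k] [Group G] [AddCommGroup V]
    [Module k V] (σ : Representation k G V) (h : (Set.range σ).Finite) :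
    (MonoidHom.ker σ).FiniteIndex := by
  have := h.to_subtype
  let φ : G ⧸ MonoidHom.ker σ → Set.range σ := fun q => ⟨σ q.out, q.out, rfl⟩
  have hφ : Function.Injective φ := by
    intro a b hab
    have hab' : σ a.out = σ b.out := congrArg Subtype.val hab
    rw [← QuotientGroup.out_eq' a, ← QuotientGroup.out_eq' b, QuotientGroup.eq,
      MonoidHom.mem_ker, map_mul, ← hab', ← map_mul, inv_mul_cancel, map_one]
  have := Finite.of_injective φ hφ
  exact Subgroup.finiteIndex_of_finite_quotient

theorem Representation.finite_range_of_finiteIndex {k G V : Type*} [Field k] [Group G]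
    [AddCommGroup V] [Module k V] (σ : Representation k G V) (N : Subgroup G) [N.FiniteIndex]
    (h : ∀ x ∈ N, σ x = 1) : (Set.range σ).Finite := by
  have := Subgroup.finite_quotient_of_finiteIndex (H := N)
  refine (Set.finite_range fun q : G ⧸ N => σ q.out).subset ?_
  rintro _ ⟨x, rfl⟩
  exact ⟨QuotientGroup.mk x, Representation.apply_out_mk h x⟩

theorem Representation.coind_eq_one {k G V : Type*} [Field k] [Group G] [AddCommGroup V]
    [Module k V] {H : Subgroup G} (σ : Representation k H V) (N : Subgroup G) [N.Normal]
    (hN : ∀ x ∈ N, ∃ hx : x ∈ H, σ ⟨x, hx⟩ = 1) {x : G} (hx : x ∈ N) :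
    Representation.coind H.subtype σ x = 1 := by
  refine LinearMap.ext fun f => Subtype.ext (funext fun g => ?_)
  obtain ⟨h1, h2⟩ := hN _ (‹N.Normal›.conj_mem x hx g)
  have h3 := f.2 ⟨_, h1⟩ g
  rw [h2] at h3
  have h4 : f.1 (g * x) = f.1 g := by simpa using h3
  exact h4

theorem Representation.trace_tprod {k G V W : Type*} [Field k] [Group G] [AddCommGroup V]
    [Module k V] [FiniteDimensional k V] [AddCommGroup W] [Module k W] [FiniteDimensional k W]
    (ρ : Representation k G V) (τ : Representation k G W) (g : G) :
    LinearMap.trace k _ (ρ.tprod τ g) = LinearMap.trace k V (ρ g) * LinearMap.trace k W (τ g) := by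
  rw [Representation.tprod_apply, LinearMap.trace_tensorProduct']

/-- Some power `x ^ s` with `s ≡ 1 (mod n)` has order prime to `ℓ` modulo a given normal subgroup
of finite index. -/
theorem exists_pow_modEq_one_pow_mem {G : Type*} [Group G] (N : Subgroup G) [N.Normal]
    [N.FiniteIndex] (ℓ : ℕ) [Fact ℓ.Prime] (x : G) {n : ℕ} (hn : n.Coprime ℓ) :
    ∃ s m : ℕ, m.Coprime ℓ ∧ s ≡ 1 [MOD n] ∧ (x ^ s) ^ m ∈ N := by
  obtain ⟨a, m, hm, hN⟩ := Nat.exists_eq_pow_mul_and_not_dvd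
    (Subgroup.FiniteIndex.index_ne_zero (H := N)) ℓ (Fact.out : ℓ.Prime).ne_one
  obtain ⟨s, hs1, hs2⟩ := Nat.chineseRemainder (hn.pow_right a) 1 0
  obtain ⟨t, rfl⟩ := (Nat.modEq_zero_iff_dvd).1 hs2
  refine ⟨_, m, ((Nat.Prime.coprime_iff_not_dvd Fact.out).2 hm).symm, hs1, ?_⟩
  rw [← pow_mul, mul_right_comm, ← hN, pow_mul]
  exact pow_mem (N.pow_index_mem x) t

theorem pow_eq_self_of_modEq_one {M : Type*} [Monoid M] {x : M} {n s : ℕ} (hx : x ^ n = 1)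
    (hs : s ≡ 1 [MOD n]) : x ^ s = x := by
  rw [pow_eq_pow_mod s hx, show s % n = 1 % n from hs, ← pow_eq_pow_mod 1 hx, pow_one]

/-- If `P` has order prime to `ℓ` modulo `N`, and so has `h`, then so have the elements of `P h`. -/
theorem mul_pow_mem_of_mem {G : Type*} [Group G] {P N : Subgroup G} [P.Normal] [N.Normal] {ℓ : ℕ}
    (hP : ∀ x ∈ P, ∃ n : ℕ, n.Coprime ℓ ∧ x ^ n ∈ N) {x h : G} (hx : x ∈ P) {m : ℕ}
    (hm : m.Coprime ℓ) (hh : h ^ m ∈ N) : ∃ n : ℕ, n.Coprime ℓ ∧ (x * h) ^ n ∈ N := by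
  have h1 : (x * h) ^ m * (h ^ m)⁻¹ ∈ P := by
    rw [← QuotientGroup.eq_one_iff]
    have hx' : (QuotientGroup.mk x : G ⧸ P) = 1 := (QuotientGroup.eq_one_iff x).2 hx
    simp [hx']
  obtain ⟨n, hn, h2⟩ := hP _ h1
  refine ⟨m * n, hm.mul_left hn, ?_⟩
  rw [← QuotientGroup.eq_one_iff] at h2 hh ⊢
  simp only [QuotientGroup.mk_pow, QuotientGroup.mk_mul, QuotientGroup.mk_inv] at h2 hh ⊢
  rw [hh, inv_one, mul_one] at h2
  rw [pow_mul, h2]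

section

variable {k G : Type*} [Field k] [IsAlgClosed k] [CharZero k] [Group G] {P H : Subgroup G}
  [P.Normal] {V T : Type*} [AddCommGroup V] [Module k V]
  [FiniteDimensional k V] [AddCommGroup T] [Module k T] [FiniteDimensional k T]

/-- The trace of `τ` is recovered from that of the induced representation of `ρ ⊗ τ` by pairing
with `ρ` along the coset `P h`: by orthogonality, only the trivial coset of `H` contributes. -/
theorem sum_trace_mul_trace_coind (hPH : P ≤ H) [Fintype (G ⧸ H)] (K : Subgroup P) [K.Normal]
    [Fintype (P ⧸ K)] (ρ : Representation k H V) (τ : Representation k H T)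
    (hρ : ∀ g : G, ∀ x ∈ K, ρ (Subgroup.inclusion hPH (MulAut.conjNormal g x)) = 1)
    (hτ : ∀ x : P, τ (Subgroup.inclusion hPH x) = 1)
    (hirr : Representation.IsIrreducible (ρ.comp (Subgroup.inclusion hPH)))
    (hne : ∀ g ∉ H, IsEmpty (Representation.Equiv ((ρ.comp (Subgroup.inclusion hPH)).comp
      (MulAut.conjNormal g : MulAut P).toMonoidHom) (ρ.comp (Subgroup.inclusion hPH)))) (h : H) :
    ∑ q : P ⧸ K, LinearMap.trace k V (ρ (Subgroup.inclusion hPH q.out * h)⁻¹) *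
      LinearMap.trace k _ (Representation.coind H.subtype (ρ.tprod τ) (q.out * h : G)) =
      Fintype.card (P ⧸ K) * LinearMap.trace k T (τ h) := by
  classical
  simp_rw [trace_coind, Finset.mul_sum]
  rw [Finset.sum_comm]
  set A : Representation k P V := ρ.comp (Subgroup.inclusion hPH) with hAdef
  have hA : ∀ x ∈ K, A x = 1 := fun x hx => by
    have := hρ 1 x hx
    rw [map_one] at this
    exact this
  have hY : ∀ x : P, ρ (Subgroup.inclusion hPH x * h)⁻¹ = ρ h⁻¹ * A x⁻¹ := by
    intro x
    rw [mul_inv_rev, map_mul, hAdef]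
    rfl
  -- Whether the coset `c` is fixed by `x h` does not depend on `x`, as `P` is normal and in `H`.
  have hmem : ∀ (c : G ⧸ H) (x : P), c.out⁻¹ * (x * h : G) * c.out ∈ H ↔
      c.out⁻¹ * h * c.out ∈ H := by
    intro c x
    have h1 : c.out⁻¹ * (x * h : G) * c.out =
        (c.out⁻¹ * x * c.out⁻¹⁻¹) * (c.out⁻¹ * h * c.out) := by group
    rw [h1, H.mul_mem_cancel_left (hPH (‹P.Normal›.conj_mem _ x.2 _))]
  rw [Finset.sum_eq_single_of_mem (QuotientGroup.mk 1) (Finset.mem_univ _)]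
  · have hout : (QuotientGroup.mk 1 : G ⧸ H).out ∈ H := by
      have := QuotientGroup.eq.1 (QuotientGroup.out_eq' (QuotientGroup.mk 1 : G ⧸ H)).symm
      simpa using this
    have hterm : ∀ q : P ⧸ K, LinearMap.trace k V (ρ (Subgroup.inclusion hPH q.out * h)⁻¹) *
        (if hm : (QuotientGroup.mk 1 : G ⧸ H).out⁻¹ * (q.out * h : G) *
          (QuotientGroup.mk 1 : G ⧸ H).out ∈ H then
          LinearMap.trace k _ (ρ.tprod τ ⟨_, hm⟩) else 0) =
        (LinearMap.trace k V (ρ h⁻¹ * A q.out⁻¹) * LinearMap.trace k V (A q.out * ρ h)) *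
          LinearMap.trace k T (τ h) := by
      intro q
      rw [dif_pos ((hmem _ _).2 (H.mul_mem (H.mul_mem (H.inv_mem hout) h.2) hout)), hY,
        mul_assoc (LinearMap.trace k V (ρ h⁻¹ * A q.out⁻¹))]
      congr 1
      have h1 : (⟨_, (hmem (QuotientGroup.mk 1) q.out).2
          (H.mul_mem (H.mul_mem (H.inv_mem hout) h.2) hout)⟩ : H) =
          (⟨_, hout⟩ : H)⁻¹ * (Subgroup.inclusion hPH q.out * h) * ⟨_, hout⟩ := rfl
      refine (congrArg (fun y => LinearMap.trace k _ (ρ.tprod τ y)) h1).trans ?_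
      rw [map_mul, LinearMap.trace_mul_comm, ← map_mul, mul_inv_cancel_left,
        Representation.trace_tprod, map_mul τ, hτ, one_mul, map_mul ρ]
      rfl
    rw [Finset.sum_congr rfl fun q _ => hterm q, ← Finset.sum_mul,
      sum_trace_mul_trace_eq_card hA (ρ h⁻¹) (ρ h) (by rw [← map_mul, inv_mul_cancel, map_one])]
  · intro c _ hc
    by_cases hm : c.out⁻¹ * h * c.out ∈ H
    · have hout : c.out⁻¹ ∉ H := by
        intro hmem
        refine hc ?_
        rw [← QuotientGroup.out_eq' c, QuotientGroup.eq]
        simpa using hmem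
      have hB' := hirr.comp_surjective (MulAut.conjNormal c.out⁻¹ : MulAut P).toMonoidHom
        (MulAut.conjNormal c.out⁻¹ : MulAut P).surjective
      set B : Representation k P V :=
        A.comp (MulAut.conjNormal c.out⁻¹ : MulAut P).toMonoidHom with hBdef
      have hB : ∀ x ∈ K, B x = 1 := fun x hx => hρ c.out⁻¹ x hx
      have hterm : ∀ q : P ⧸ K, LinearMap.trace k V (ρ (Subgroup.inclusion hPH q.out * h)⁻¹) *
          (if hm : c.out⁻¹ * (q.out * h : G) * c.out ∈ H then
            LinearMap.trace k _ (ρ.tprod τ ⟨_, hm⟩) else 0) =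
          (LinearMap.trace k V (ρ h⁻¹ * A q.out⁻¹) *
            LinearMap.trace k V (B q.out * ρ ⟨_, hm⟩)) * LinearMap.trace k T (τ ⟨_, hm⟩) := by
        intro q
        rw [dif_pos ((hmem _ _).2 hm), hY,
          mul_assoc (LinearMap.trace k V (ρ h⁻¹ * A q.out⁻¹))]
        congr 1
        have h1 : (⟨_, (hmem c q.out).2 hm⟩ : H) =
            Subgroup.inclusion hPH (MulAut.conjNormal c.out⁻¹ q.out) * ⟨_, hm⟩ :=
          Subtype.ext (by simp [mul_assoc])
        refine (congrArg (fun y => LinearMap.trace k _ (ρ.tprod τ y)) h1).trans ?_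
        rw [Representation.trace_tprod, map_mul τ, hτ, one_mul, map_mul ρ]
        rfl
      rw [Finset.sum_congr rfl fun q _ => hterm q, ← Finset.sum_mul,
        sum_trace_mul_trace_eq_zero hA hB (hne _ hout), zero_mul]
    · refine Finset.sum_eq_zero fun q _ => ?_
      rw [dif_neg (mt (hmem _ _).1 hm), mul_zero]

end

/-- Let `P ≤ H ≤ G` with `P` normal and `H` of finite index, and let `ρ` be a representation of `H`
with finite image and irreducible restriction to `P`, such that the isotropy group in `G` of the
restriction is contained in `H`. If `P` has order prime to `ℓ` modulo a normal subgroup `D` on which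
`ρ` is trivial, then inducing `ρ ⊗ τ` preserves and reflects congruence of representations `τ` of
`H` that have finite image and are trivial on `P`. -/
theorem congruentMod_coind_tprod_iff {ℓ : ℕ} [Fact ℓ.Prime] {G : Type*} [Group G]
    {P H D : Subgroup G} [P.Normal] [D.Normal] [H.FiniteIndex] (hPH : P ≤ H) (hDP : D ≤ P)
    (hD : ∀ x ∈ P, ∃ n : ℕ, n.Coprime ℓ ∧ x ^ n ∈ D)
    {V T₁ T₂ : Type*} [AddCommGroup V] [Module (PadicAlgCl ℓ) V]
    [FiniteDimensional (PadicAlgCl ℓ) V]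
    [AddCommGroup T₁] [Module (PadicAlgCl ℓ) T₁] [FiniteDimensional (PadicAlgCl ℓ) T₁]
    [AddCommGroup T₂] [Module (PadicAlgCl ℓ) T₂] [FiniteDimensional (PadicAlgCl ℓ) T₂]
    (ρ : Representation (PadicAlgCl ℓ) H V) (τ₁ : Representation (PadicAlgCl ℓ) H T₁)
    (τ₂ : Representation (PadicAlgCl ℓ) H T₂)
    (hρfin : (Set.range ρ).Finite) (hτ₁fin : (Set.range τ₁).Finite) (hτ₂fin : (Set.range τ₂).Finite)
    (hρD : ∀ x : D, ρ (Subgroup.inclusion (hDP.trans hPH) x) = 1)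
    (hτ₁ : ∀ x : P, τ₁ (Subgroup.inclusion hPH x) = 1)
    (hτ₂ : ∀ x : P, τ₂ (Subgroup.inclusion hPH x) = 1)
    (hirr : Representation.IsIrreducible (ρ.comp (Subgroup.inclusion hPH)))
    (hne : ∀ g ∉ H, IsEmpty (Representation.Equiv ((ρ.comp (Subgroup.inclusion hPH)).comp
      (MulAut.conjNormal g : MulAut P).toMonoidHom) (ρ.comp (Subgroup.inclusion hPH)))) :
    CongruentMod (Representation.coind H.subtype (ρ.tprod τ₁))
      (Representation.coind H.subtype (ρ.tprod τ₂)) ↔ CongruentMod τ₁ τ₂ := by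
  classical
  have := ρ.finiteIndex_ker hρfin
  have := τ₁.finiteIndex_ker hτ₁fin
  have := τ₂.finiteIndex_ker hτ₂fin
  -- All the representations factor through the finite group `G ⧸ N`.
  let K₁ : Subgroup G := (MonoidHom.ker ρ ⊓ (MonoidHom.ker τ₁ ⊓ MonoidHom.ker τ₂)).map H.subtype
  have hK₁ : K₁.FiniteIndex := by
    refine ⟨?_⟩
    rw [Subgroup.index_map_subtype]
    exact mul_ne_zero Subgroup.FiniteIndex.index_ne_zero Subgroup.FiniteIndex.index_ne_zero
  let N : Subgroup G := K₁.normalCore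
  have hN : ∀ x ∈ N, ∃ hx : x ∈ H, ρ ⟨x, hx⟩ = 1 ∧ τ₁ ⟨x, hx⟩ = 1 ∧ τ₂ ⟨x, hx⟩ = 1 := by
    intro x hx
    obtain ⟨y, ⟨h1, h2, h3⟩, rfl⟩ := K₁.normalCore_le hx
    exact ⟨y.2, h1, h2, h3⟩
  have hDN : D ≤ N := by
    refine Subgroup.normal_le_normalCore.2 fun x hx => ?_
    exact ⟨⟨x, hPH (hDP hx)⟩, ⟨hρD ⟨x, hx⟩, hτ₁ ⟨x, hDP hx⟩, hτ₂ ⟨x, hDP hx⟩⟩, rfl⟩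
  have hI₁ : ∀ x ∈ N, Representation.coind H.subtype (ρ.tprod τ₁) x = 1 := fun x hx =>
    Representation.coind_eq_one _ N (fun x hx => by
      obtain ⟨h, h1, h2, -⟩ := hN x hx
      exact ⟨h, by rw [Representation.tprod_apply, h1, h2]; exact TensorProduct.map_one⟩) hx
  have hI₂ : ∀ x ∈ N, Representation.coind H.subtype (ρ.tprod τ₂) x = 1 := fun x hx =>
    Representation.coind_eq_one _ N (fun x hx => by
      obtain ⟨h, h1, -, h2⟩ := hN x hx
      exact ⟨h, by rw [Representation.tprod_apply, h1, h2]; exact TensorProduct.map_one⟩) hx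
  have := finiteDimensional_coindV (ρ.tprod τ₁)
  have := finiteDimensional_coindV (ρ.tprod τ₂)
  have : Fintype (G ⧸ H) := Subgroup.fintypeQuotientOfFiniteIndex
  rw [congruentMod_iff_trace (Representation.finite_range_of_finiteIndex _ N hI₁)
    (Representation.finite_range_of_finiteIndex _ N hI₂), congruentMod_iff_trace hτ₁fin hτ₂fin]
  constructor
  · intro hyp h n hn h1 h2
    -- Replacing `h` by `h ^ s` changes neither `τ₁ h` nor `τ₂ h`, and makes its order in `G ⧸ N`
    -- prime to `ℓ`.
    obtain ⟨s, m, hm, hs, hmem⟩ := exists_pow_modEq_one_pow_mem N ℓ (h : G) hn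
    let K : Subgroup P := N.subgroupOf P
    have : Fintype (P ⧸ K) := Subgroup.fintypeQuotientOfFiniteIndex
    have hρK : ∀ g : G, ∀ x ∈ K, ρ (Subgroup.inclusion hPH (MulAut.conjNormal g x)) = 1 := by
      intro g x hx
      obtain ⟨_, h, -⟩ := hN _ (Subgroup.Normal.conj_mem inferInstance (x : G) hx g)
      exact h
    have e1 := sum_trace_mul_trace_coind hPH K ρ τ₁ hρK hτ₁ hirr hne (h ^ s)
    have e2 := sum_trace_mul_trace_coind hPH K ρ τ₂ hρK hτ₂ hirr hne (h ^ s)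
    have h3 : ∀ q : P ⧸ K, LinearMap.trace _ _
          (Representation.coind H.subtype (ρ.tprod τ₁) (q.out * (h ^ s : H) : G)) =
        LinearMap.trace _ _
          (Representation.coind H.subtype (ρ.tprod τ₂) (q.out * (h ^ s : H) : G)) := by
      intro q
      obtain ⟨r, hr, hr2⟩ := mul_pow_mem_of_mem (N := N)
        (fun x hx => (hD x hx).imp fun n h => ⟨h.1, hDN h.2⟩) q.out.2 hm hmem
      exact hyp _ r hr (by rw [← map_pow]; exact hI₁ _ hr2) (by rw [← map_pow]; exact hI₂ _ hr2)
    simp_rw [h3] at e1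
    rw [e2] at e1
    have h4 := mul_left_cancel₀ (Nat.cast_ne_zero.2 Fintype.card_ne_zero) e1
    rw [map_pow τ₁, map_pow τ₂, pow_eq_self_of_modEq_one h1 hs,
      pow_eq_self_of_modEq_one h2 hs] at h4
    exact h4.symm
  · intro hyp g n hn h1 h2
    -- As above, `g` is replaced by `g ^ s`, of order prime to `ℓ` in `G ⧸ N`.
    obtain ⟨s, m, hm, hs, hmem⟩ := exists_pow_modEq_one_pow_mem N ℓ g hn
    rw [← pow_eq_self_of_modEq_one h1 hs, ← pow_eq_self_of_modEq_one h2 hs, ← map_pow, ← map_pow,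
      trace_coind, trace_coind]
    refine Finset.sum_congr rfl fun c _ => ?_
    by_cases hc : c.out⁻¹ * g ^ s * c.out ∈ H
    · rw [dif_pos hc, dif_pos hc, Representation.trace_tprod, Representation.trace_tprod]
      congr 1
      have hcN : (c.out⁻¹ * g ^ s * c.out) ^ m ∈ N := by
        have h3 : (c.out⁻¹ * g ^ s * c.out) ^ m = c.out⁻¹ * (g ^ s) ^ m * c.out⁻¹⁻¹ := by
          rw [← conj_pow, inv_inv]
        rw [h3]
        exact Subgroup.Normal.conj_mem inferInstance _ hmem _
      obtain ⟨_, -, h3, h4⟩ := hN _ hcN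
      refine hyp _ m hm ?_ ?_
      · rw [← map_pow]; exact h3
      · rw [← map_pow]; exact h4
    · rw [dif_neg hc, dif_neg hc]

/-! ### Irreducible representations with finite image -/

theorem Representation.IsIrreducible.eq_top {k G V : Type*} [Field k] [Group G] [AddCommGroup V]
    [Module k V] {σ : Representation k G V} (hσ : σ.IsIrreducible) {S : Submodule k V}
    (hS : ∀ g, ∀ v ∈ S, σ g v ∈ S) (hne : S ≠ ⊥) : S = ⊤ := by
  rcases hσ.eq_bot_or_eq_top (⟨S, fun g v hv => hS g v hv⟩ : Subrepresentation σ) with h | h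
  · exact absurd (congrArg Subrepresentation.toSubmodule h) hne
  · exact congrArg Subrepresentation.toSubmodule h

theorem Representation.IsIrreducible.nontrivial {k G V : Type*} [Field k] [Group G]
    [AddCommGroup V] [Module k V] {σ : Representation k G V} (hσ : σ.IsIrreducible) :
    Nontrivial V := by
  by_contra h
  rw [not_nontrivial_iff_subsingleton] at h
  have := hσ.toNontrivial
  refine bot_ne_top (α := Subrepresentation σ) (Subrepresentation.toSubmodule_injective ?_)
  exact Subsingleton.elim _ _

theorem Representation.IsIrreducible.of_restrict {k G G' V : Type*} [Field k] [Group G]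
    [Group G'] [AddCommGroup V] [Module k V] {σ : Representation k G V} (f : G' →* G)
    (h : Representation.IsIrreducible (σ.comp f)) : σ.IsIrreducible := by
  have := h.nontrivial
  refine { exists_pair_ne := ⟨⊥, ⊤, fun h0 => ?_⟩, eq_bot_or_eq_top := fun S => ?_ }
  · exact bot_ne_top (α := Submodule k V) (congrArg Subrepresentation.toSubmodule h0)
  · by_cases h0 : S.toSubmodule = ⊥
    · exact Or.inl (Subrepresentation.toSubmodule_injective h0)
    · refine Or.inr (Subrepresentation.toSubmodule_injective ?_)
      exact h.eq_top (fun g v hv => S.apply_mem_toSubmodule (f g) hv) h0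

theorem Representation.IsIrreducible.of_equiv {k G V W : Type*} [Field k] [Group G]
    [AddCommGroup V] [Module k V] [AddCommGroup W] [Module k W] {σ : Representation k G V}
    {σ' : Representation k G W} (e : σ.Equiv σ') (h : σ'.IsIrreducible) : σ.IsIrreducible := by
  have := h.nontrivial
  have := e.toLinearEquiv.toEquiv.nontrivial
  refine { exists_pair_ne := ⟨⊥, ⊤, fun h0 => ?_⟩, eq_bot_or_eq_top := fun S => ?_ }
  · exact bot_ne_top (α := Submodule k V) (congrArg Subrepresentation.toSubmodule h0)
  · by_cases h0 : S.toSubmodule = ⊥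
    · exact Or.inl (Subrepresentation.toSubmodule_injective h0)
    · refine Or.inr (Subrepresentation.toSubmodule_injective ?_)
      have h1 : S.toSubmodule.map e.toLinearEquiv.toLinearMap = ⊤ := by
        refine h.eq_top (fun g v hv => ?_) fun hb => h0 ?_
        · obtain ⟨w, hw, rfl⟩ := hv
          exact ⟨σ g w, S.apply_mem_toSubmodule g hw,
            LinearMap.congr_fun (e.isIntertwining' g) w⟩
        · exact (Submodule.map_eq_bot_iff (e := e.toLinearEquiv)).1 hb
      exact (Submodule.map_eq_top_iff (e := e.toLinearEquiv)).1 h1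

/-- An irreducible representation with a nonzero vector fixed by a subgroup of finite index is
finite-dimensional. -/
theorem Representation.IsIrreducible.finiteDimensional {k G V : Type*} [Field k] [Group G]
    [AddCommGroup V] [Module k V] {σ : Representation k G V} (hσ : σ.IsIrreducible)
    (N : Subgroup G) [N.FiniteIndex] {v : V} (hv : v ≠ 0) (hN : ∀ x ∈ N, σ x v = v) :
    FiniteDimensional k V := by
  have := Subgroup.finite_quotient_of_finiteIndex (H := N)
  have hfin : (Set.range fun g => σ g v).Finite := by
    refine (Set.finite_range fun q : G ⧸ N => σ q.out v).subset ?_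
    rintro _ ⟨x, rfl⟩
    refine ⟨QuotientGroup.mk x, ?_⟩
    have := hN _ (QuotientGroup.eq.1 (QuotientGroup.out_eq' (QuotientGroup.mk x : G ⧸ N)).symm)
    dsimp only
    rw [← mul_inv_cancel_left x (QuotientGroup.mk x : G ⧸ N).out, map_mul, Module.End.mul_apply,
      this]
  have htop : Submodule.span k (Set.range fun g => σ g v) = ⊤ := by
    refine hσ.eq_top (fun g w hw => ?_) fun h0 => hv ?_
    · have := Submodule.mem_map_of_mem (f := σ g) hw
      rw [Submodule.map_span] at this
      refine Submodule.span_mono ?_ this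
      rintro _ ⟨_, ⟨x, rfl⟩, rfl⟩
      exact ⟨g * x, by simp⟩
    · have : v ∈ Submodule.span k (Set.range fun g => σ g v) :=
        Submodule.subset_span ⟨1, by simp⟩
      rwa [h0] at this
  exact ⟨⟨hfin.toFinset, by simpa using htop⟩⟩

/-- If an irreducible representation has a nonzero vector fixed by the normal subgroup `P`, then `P`
acts trivially, because the `P`-fixed vectors form a subrepresentation. -/
theorem Representation.IsIrreducible.eq_one_of_mem_normal {k G V : Type*} [Field k] [Group G]
    [AddCommGroup V] [Module k V] {σ : Representation k G V} (hσ : σ.IsIrreducible)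
    (P : Subgroup G) [P.Normal] {v : V} (hv : v ≠ 0) (hP : ∀ x ∈ P, σ x v = v) {x : G}
    (hx : x ∈ P) : σ x = 1 := by
  let S : Submodule k V := ⨅ x : P, LinearMap.ker (σ x - 1)
  have hmem : ∀ w, w ∈ S ↔ ∀ x ∈ P, σ x w = w := by
    intro w
    simp [S, Submodule.mem_iInf, sub_eq_zero]
  have htop : S = ⊤ := by
    refine hσ.eq_top (fun g w hw => ?_) fun h0 => hv ?_
    · rw [hmem] at hw ⊢
      intro y hy
      have h1 := hw _ (Subgroup.Normal.conj_mem inferInstance y hy g⁻¹)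
      have h2 : y * g = g * (g⁻¹ * y * g⁻¹⁻¹) := by group
      rw [← Module.End.mul_apply, ← map_mul, h2, map_mul, Module.End.mul_apply, h1]
    · have : v ∈ S := (hmem v).2 hP
      rwa [h0] at this
  ext w
  exact (hmem w).1 (htop ▸ Submodule.mem_top) x hx

/-- Let `σ` be irreducible with determinant of finite order, and let the normal subgroup `I` have
finite image and cyclic quotient, generated by `Φ`. Then the image of `σ` is finite: a power of
`σ Φ` commutes with the finite image of `I`, hence is scalar by Schur's lemma, and the determinant
shows that the scalar is a root of unity. -/
theorem Representation.IsIrreducible.finite_range {k G V : Type*} [Field k] [IsAlgClosed k]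
    [Group G] [AddCommGroup V] [Module k V] [FiniteDimensional k V] {σ : Representation k G V}
    (hσ : σ.IsIrreducible) (hdet : σ.DetFiniteOrder) (I : Subgroup G) [I.Normal]
    (hI : (σ '' I).Finite) (Φ : G) (hΦ : ∀ w : G, ∃ n : ℤ, w * Φ ^ n ∈ I) :
    (Set.range σ).Finite := by
  have := hI.to_subtype
  -- Conjugation by the powers of `σ Φ` permutes the finite set `σ '' I`.
  let f : ℕ → (σ '' (I : Set G)) → (σ '' (I : Set G)) := fun n j =>
    ⟨σ (Φ ^ n) * j * σ (Φ ^ n)⁻¹, by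
      obtain ⟨_, i, hi, rfl⟩ := j
      exact ⟨Φ ^ n * i * (Φ ^ n)⁻¹, Subgroup.Normal.conj_mem inferInstance i hi _, by simp⟩⟩
  obtain ⟨a, b, hab, hf⟩ : ∃ a b : ℕ, a < b ∧ f a = f b := by
    obtain ⟨a, b, hab, hf⟩ := Finite.exists_ne_map_eq_of_infinite f
    rcases lt_or_gt_of_ne hab with h | h
    · exact ⟨a, b, h, hf⟩
    · exact ⟨b, a, h, hf.symm⟩
  obtain ⟨n, hn, rfl⟩ : ∃ n, 0 < n ∧ b = a + n := ⟨b - a, by omega, by omega⟩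
  have hcomm : ∀ i ∈ I, σ (Φ ^ n) * σ i = σ i * σ (Φ ^ n) := by
    intro i hi
    have h1 := congrArg Subtype.val (congrFun hf ⟨σ i, i, hi, rfl⟩)
    simp only [f, ← map_mul] at h1
    have h2 := congrArg (fun y => σ (Φ ^ a)⁻¹ * y * σ (Φ ^ (a + n))) h1
    simp only [← map_mul] at h2
    rw [← map_mul, ← map_mul]
    convert h2.symm using 2 <;> simp only [pow_add] <;> group
  have hcomm' : ∀ w, σ (Φ ^ n) * σ w = σ w * σ (Φ ^ n) := by
    intro w
    obtain ⟨m, hm⟩ := hΦ w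
    have h1 := hcomm _ hm
    have h2 : w = (w * Φ ^ m) * Φ ^ (-m) := by group
    have h3 : σ (Φ ^ n) * σ (Φ ^ (-m)) = σ (Φ ^ (-m)) * σ (Φ ^ n) := by
      rw [← map_mul, ← map_mul, ← zpow_natCast, ← zpow_add, ← zpow_add, add_comm]
    rw [h2, map_mul σ (w * Φ ^ m), ← mul_assoc, h1, mul_assoc, h3, mul_assoc]
  obtain ⟨c, hc⟩ :=
    (Representation.IsIrreducible.algebraMap_intertwiningMap_bijective_of_isAlgClosed (ρ := σ)).2
      ⟨σ (Φ ^ n), fun g => hcomm' g⟩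
  have hc' : σ (Φ ^ n) = c • 1 := (congrArg (fun t => t.toLinearMap) hc).symm
  have := hσ.nontrivial
  obtain ⟨N, hN, hdetN⟩ := isOfFinOrder_iff_pow_eq_one.1 hdet
  have hcd : c ^ (Module.finrank k V * N) = 1 := by
    have h1 := congrArg (fun χ => χ (Φ ^ n)) hdetN
    simp only [MonoidHom.pow_apply, MonoidHom.comp_apply, MonoidHom.one_apply] at h1
    rw [hc', LinearMap.det_smul, map_one, mul_one, ← pow_mul] at h1
    exact h1
  have hfin : σ (Φ ^ (n * (Module.finrank k V * N))) = 1 := by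
    rw [pow_mul, map_pow, hc', smul_pow, hcd, one_smul, one_pow]
  set M := n * (Module.finrank k V * N) with hM
  have hMpos : 0 < M := Nat.mul_pos hn (Nat.mul_pos Module.finrank_pos hN)
  refine (Set.Finite.image2 (fun a b => a * b) hI
    (Set.finite_range fun j : Fin M => σ (Φ ^ (j : ℕ)))).subset ?_
  rintro _ ⟨w, rfl⟩
  obtain ⟨m, hm⟩ := hΦ w
  have hM0 : (M : ℤ) ≠ 0 := by exact_mod_cast hMpos.ne'
  have hmod := Int.emod_nonneg (-m) hM0
  refine ⟨_, ⟨_, hm, rfl⟩, _, ⟨⟨(-m % M).toNat, ?_⟩, rfl⟩, ?_⟩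
  · have := Int.emod_lt_of_pos (-m) (by exact_mod_cast hMpos : (0 : ℤ) < M)
    omega
  · dsimp only
    have h1 : Φ ^ (-m) = Φ ^ (-m % M).toNat * (Φ ^ M) ^ (-m / M) := by
      rw [← zpow_natCast, ← zpow_natCast, ← zpow_mul, ← zpow_add, Int.toNat_of_nonneg hmod,
        Int.emod_add_mul_ediv]
    have h2 : ∀ z : ℤ, σ ((Φ ^ M) ^ z) = 1 := by
      have hker : Φ ^ M ∈ MonoidHom.ker σ := hfin
      exact fun z => zpow_mem hker z
    calc σ (w * Φ ^ m) * σ (Φ ^ (-m % M).toNat)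
        = σ (w * Φ ^ m) * (σ (Φ ^ (-m % M).toNat) * σ ((Φ ^ M) ^ (-m / M))) := by
          rw [h2, mul_one]
      _ = σ w := by rw [← map_mul, ← h1, ← map_mul]; congr 1; group

/-! ### Wild inertia is a pro-`p` group -/

section WildInertia

variable {F Fbar : Type*} [Field F] [ValuativeRel F] [Field Fbar] [Algebra F Fbar]

instance : (inertiaSubgroup F Fbar).Normal where
  conj_mem := by
    intro w hw g x
    have h := galInt_mem (WeilGroup.toGal F Fbar g) (hw (galInt (WeilGroup.toGal F Fbar g)⁻¹ x))
    rw [map_sub, galInt_galInt_inv] at h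
    rw [map_mul, map_mul, map_inv, galInt_mul, galInt_mul]
    exact h

theorem wildInertia_le_inertiaSubgroup : wildInertia F Fbar ≤ inertiaSubgroup F Fbar := by
  intro w hw x
  obtain ⟨y, hy, hxy⟩ := hw x
  have h : galInt (WeilGroup.toGal F Fbar w) x - x = x * y := by
    apply Subtype.ext
    have : ((galInt (WeilGroup.toGal F Fbar w) x : integersBar F Fbar) : Fbar)
      = WeilGroup.toGal F Fbar w x := rfl
    push_cast
    rw [this, hxy]
    ring
  rw [h]
  exact Ideal.mul_mem_left _ _ hy

theorem isUnit_natCast_of_prime_ne {p ℓ : ℕ} [CharP 𝓀[F] p] (hℓ : ℓ.Prime) (hpℓ : p ≠ ℓ) :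
    IsUnit (ℓ : 𝒪[F]) := by
  rw [← IsLocalRing.residue_ne_zero_iff_isUnit, map_natCast, Ne, CharP.cast_eq_zero_iff 𝓀[F] p]
  intro h
  rcases (Nat.dvd_prime hℓ).1 h with h | h
  · exact CharP.char_ne_one 𝓀[F] p h
  · exact hpℓ h

/-- If `w` is in the wild inertia group and `w ^ ℓ` fixes `a`, then so does `w`: the conjugates of
`x = a - w a` under the powers of `w` have sum zero, but they are all congruent to `x` up to a
factor in `1 + 𝔪`, and `ℓ` is a unit. -/
theorem eq_of_mem_wildInertia_of_pow_eq {p ℓ : ℕ} [CharP 𝓀[F] p] (hℓ : ℓ.Prime) (hpℓ : p ≠ ℓ)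
    {w : WeilGroup F Fbar} (hw : w ∈ wildInertia F Fbar) {a : Fbar}
    (ha : WeilGroup.toGal F Fbar (w ^ ℓ) a = a) : WeilGroup.toGal F Fbar w a = a := by
  by_contra hne
  set x := a - WeilGroup.toGal F Fbar w a with hx
  have hx0 : x ≠ 0 := fun h => hne (sub_eq_zero.1 h).symm
  choose y hy hxy using fun i : ℕ => pow_mem hw i x
  have hsum : ∑ i ∈ Finset.range ℓ, WeilGroup.toGal F Fbar (w ^ i) x = 0 := by
    have h1 : ∀ i : ℕ, WeilGroup.toGal F Fbar (w ^ i) x =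
        WeilGroup.toGal F Fbar (w ^ i) a - WeilGroup.toGal F Fbar (w ^ (i + 1)) a := by
      intro i
      rw [hx, map_sub, pow_succ, map_mul, AlgEquiv.mul_apply]
    rw [Finset.sum_congr rfl fun i _ => h1 i, Finset.sum_range_sub', ha, pow_zero, map_one]
    exact sub_self a
  rw [Finset.sum_congr rfl fun i _ => hxy i, ← Finset.mul_sum, Finset.sum_add_distrib,
    Finset.sum_const, Finset.card_range, nsmul_eq_mul, mul_one] at hsum
  have h2 : (ℓ : integersBar F Fbar) + ∑ i ∈ Finset.range ℓ, y i = 0 := by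
    apply Subtype.ext
    push_cast
    exact (mul_eq_zero.1 hsum).resolve_left hx0
  have h3 : (ℓ : integersBar F Fbar) ∈ maxIdealBar F Fbar := by
    rw [eq_neg_of_add_eq_zero_left h2]
    exact neg_mem (sum_mem fun i _ => hy i)
  have h4 : IsUnit (ℓ : integersBar F Fbar) := by
    have := (isUnit_natCast_of_prime_ne (F := F) hℓ hpℓ).map (algebraMap 𝒪[F] (integersBar F Fbar))
    rwa [map_natCast] at this
  obtain ⟨u, hu⟩ := h4.exists_right_inv
  have h5 := Ideal.mem_jacobson_bot.1 h3 (-u)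
  rw [show (ℓ : integersBar F Fbar) * -u + 1 = 0 by linear_combination -hu] at h5
  exact not_isUnit_zero h5

theorem mem_weilSubgroupOf {K : IntermediateField F Fbar} {w : WeilGroup F Fbar} :
    w ∈ weilSubgroupOf Fbar K ↔ ∀ a ∈ K, WeilGroup.toGal F Fbar w a = a := by
  rw [weilSubgroupOf, Subgroup.mem_comap, IntermediateField.mem_fixingSubgroup_iff]

instance [IsGalois F Fbar] (K : IntermediateField F Fbar) [Normal F K] :
    (weilSubgroupOf Fbar K).Normal := by
  have : IsGalois F K := {}
  unfold weilSubgroupOf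
  infer_instance

instance [IsGalois F Fbar] (K : IntermediateField F Fbar) [FiniteDimensional F K] :
    (weilSubgroupOf Fbar K).FiniteIndex := by
  have : K.fixingSubgroup.FiniteIndex := by
    refine ⟨?_⟩
    rw [← IntermediateField.finrank_eq_fixingSubgroup_index]
    exact Module.finrank_pos.ne'
  refine ⟨?_⟩
  rw [weilSubgroupOf, Subgroup.index_comap]
  exact Subgroup.FiniteIndex.index_ne_zero (H := K.fixingSubgroup.subgroupOf _)

/-- The image of the wild inertia group in a finite Galois group has order prime to `ℓ`. -/
theorem exists_coprime_pow_mem_weilSubgroupOf [IsGalois F Fbar] {p ℓ : ℕ} [CharP 𝓀[F] p]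
    (hℓ : ℓ.Prime) (hpℓ : p ≠ ℓ) (K : IntermediateField F Fbar) [FiniteDimensional F K]
    [Normal F K] {w : WeilGroup F Fbar} (hw : w ∈ wildInertia F Fbar) :
    ∃ n : ℕ, n.Coprime ℓ ∧ w ^ n ∈ weilSubgroupOf Fbar K := by
  obtain ⟨a, m, hm, hN⟩ := Nat.exists_eq_pow_mul_and_not_dvd
    (Subgroup.FiniteIndex.index_ne_zero (H := weilSubgroupOf Fbar K)) ℓ hℓ.ne_one
  refine ⟨m, ((Nat.Prime.coprime_iff_not_dvd hℓ).2 hm).symm, ?_⟩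
  have h := (weilSubgroupOf Fbar K).pow_index_mem w
  rw [hN, mul_comm, pow_mul] at h
  clear hN
  induction a with
  | zero => simpa using h
  | succ a ih =>
    refine ih ?_
    rw [pow_succ, pow_mul] at h
    rw [mem_weilSubgroupOf] at h ⊢
    exact fun x hx => eq_of_mem_wildInertia_of_pow_eq hℓ hpℓ (pow_mem (pow_mem hw m) _) (h x hx)

end WildInertia

/-! ### Smooth representations of subgroups of the Weil group -/

section Smooth

variable {F Fbar : Type*} [Field F] [ValuativeRel F] [Field Fbar] [Algebra F Fbar]

/-- The elements of inertia that fix a finite Galois extension form a basis of neighbourhoods of the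
identity. -/
theorem exists_inf_inertiaSubgroup_subset [IsGalois F Fbar] (S : Subgroup (WeilGroup F Fbar))
    {A : Set S} (hA : IsOpen A) (h1 : (1 : S) ∈ A) :
    ∃ K : IntermediateField F Fbar, FiniteDimensional F K ∧ Normal F K ∧
      ∀ x : S, (x : WeilGroup F Fbar) ∈ weilSubgroupOf Fbar K →
        (x : WeilGroup F Fbar) ∈ inertiaSubgroup F Fbar → x ∈ A := by
  obtain ⟨B, hB, rfl⟩ := isOpen_induced_iff.1 hA
  have hnhds := hB.mem_nhds h1
  have hinf := @nhds_inf (WeilGroup F Fbar) (.induced (WeilGroup.toGal F Fbar) inferInstance)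
    (.induced (QuotientGroup.mk : _ → WeilGroup F Fbar ⧸ inertiaSubgroup F Fbar) ⊥) 1
  rw [nhds_induced, @nhds_induced _ _ ⊥, map_one] at hinf
  replace hnhds := (Filter.ext_iff.1 hinf B).1 hnhds
  rw [Filter.mem_inf_iff] at hnhds
  obtain ⟨C, ⟨C', hC', hC⟩, D, ⟨D', hD', hD⟩, rfl⟩ := hnhds
  obtain ⟨K, hK, hK', hKC⟩ := (krullTopology_mem_nhds_one_iff_of_normal F Fbar C').1 hC'
  refine ⟨K, hK, hK', fun x hx hx' => ⟨hC (hKC hx), hD ?_⟩⟩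
  have h2 : (QuotientGroup.mk (x : WeilGroup F Fbar) :
      WeilGroup F Fbar ⧸ inertiaSubgroup F Fbar) = QuotientGroup.mk 1 := by
    rw [QuotientGroup.eq]
    simpa using hx'
  rw [Set.mem_preimage, h2]
  exact @mem_of_mem_nhds _ ⊥ _ _ hD'

variable {k V : Type*} [Field k] [AddCommGroup V] [Module k V] {S : Subgroup (WeilGroup F Fbar)}

/-- The kernel of a finite-dimensional smooth representation contains the elements of inertia that
fix some finite Galois extension. -/
theorem Representation.IsSmooth.exists_eq_one [IsGalois F Fbar] [FiniteDimensional k V]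
    {σ : Representation k S V} (hσ : σ.IsSmooth) :
    ∃ K : IntermediateField F Fbar, FiniteDimensional F K ∧ Normal F K ∧
      ∀ x : S, (x : WeilGroup F Fbar) ∈ weilSubgroupOf Fbar K →
        (x : WeilGroup F Fbar) ∈ inertiaSubgroup F Fbar → σ x = 1 := by
  let b := Module.finBasis k V
  obtain ⟨K, hK, hK', h⟩ := exists_inf_inertiaSubgroup_subset S
    (isOpen_iInter_of_finite fun i => hσ (b i)) (Set.mem_iInter.2 fun i => by simp)
  exact ⟨K, hK, hK', fun x hx hx' => b.ext fun i => Set.mem_iInter.1 (h x hx hx') i⟩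

/-- An irreducible smooth representation of wild inertia is finite-dimensional, because the orbit of
a vector is finite. -/
theorem finiteDimensional_of_isSmooth_wildInertia [IsGalois F Fbar]
    {α : Representation k (wildInertia F Fbar) V} (hirr : α.IsIrreducible) (hα : α.IsSmooth) :
    FiniteDimensional k V := by
  have := hirr.nontrivial
  obtain ⟨v, hv⟩ := exists_ne (0 : V)
  obtain ⟨K, hK, hK', h⟩ := exists_inf_inertiaSubgroup_subset _ (hα v) (by simp)
  exact hirr.finiteDimensional ((weilSubgroupOf Fbar K).subgroupOf _) hv
    fun x hx => h x hx (wildInertia_le_inertiaSubgroup x.2)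

/-- Modulo inertia, every subgroup of the Weil group is cyclic. -/
theorem exists_mul_zpow_mem_inertiaSubgroup (S : Subgroup (WeilGroup F Fbar)) :
    ∃ Φ ∈ S, ∀ w ∈ S, ∃ n : ℤ, w * Φ ^ n ∈ inertiaSubgroup F Fbar := by
  classical
  have hzero : ∀ w : WeilGroup F Fbar, ActsAsFrobPow (WeilGroup.toGal F Fbar w) 0 →
      w ∈ inertiaSubgroup F Fbar := by
    intro w hw x
    have := hw x
    rwa [pow_zero, pow_one] at this
  suffices hsuff : ∃ Φ ∈ S, ∀ w ∈ S, ∀ m, ActsAsFrobPow (WeilGroup.toGal F Fbar w) m →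
      ∃ n : ℤ, w * Φ ^ n ∈ inertiaSubgroup F Fbar by
    obtain ⟨Φ, hΦ, h⟩ := hsuff
    refine ⟨Φ, hΦ, fun w hw => ?_⟩
    obtain ⟨m, hm | hm⟩ := w.2
    · exact h w hw m hm
    · obtain ⟨n, hn⟩ := h w⁻¹ (inv_mem hw) m hm
      refine ⟨-n, ?_⟩
      have h2 := Subgroup.Normal.conj_mem inferInstance _ (inv_mem hn) (Φ ^ n)
      convert h2 using 1
      group
  by_cases hex : ∃ n, 0 < n ∧ ∃ w ∈ S, ActsAsFrobPow (WeilGroup.toGal F Fbar w) n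
  · -- `Φ` acts as the smallest positive power of the Frobenius that occurs in `S`.
    obtain ⟨hpos, Φ, hΦ, hact⟩ := Nat.find_spec hex
    refine ⟨Φ, hΦ, fun w hw m => ?_⟩
    induction m using Nat.strong_induction_on generalizing w with
    | _ m ih =>
      intro hm
      rcases Nat.eq_zero_or_pos m with rfl | hm0
      · exact ⟨0, by simpa using hzero w hm⟩
      · obtain ⟨k, rfl⟩ := Nat.exists_eq_add_of_le (Nat.find_min' hex ⟨hm0, w, hw, hm⟩)
        have h1 := hm.mul_inv hact
        rw [← map_inv, ← map_mul] at h1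
        obtain ⟨n, hn⟩ := ih k (by omega) _ (mul_mem hw (inv_mem hΦ)) h1
        refine ⟨n - 1, ?_⟩
        convert hn using 1
        group
  · refine ⟨1, one_mem S, fun w hw m hm => ⟨0, ?_⟩⟩
    rcases Nat.eq_zero_or_pos m with rfl | hm0
    · simpa using hzero w hm
    · exact absurd ⟨m, hm0, w, hw, hm⟩ hex

/-- An irreducible smooth finite-dimensional representation, with determinant of finite order, of
a subgroup of the Weil group has finite image. -/
theorem Representation.IsSmooth.finite_range [IsGalois F Fbar] [IsAlgClosed k]
    [FiniteDimensional k V] {σ : Representation k S V} (hσ : σ.IsSmooth) (hirr : σ.IsIrreducible)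
    (hdet : σ.DetFiniteOrder) : (Set.range σ).Finite := by
  obtain ⟨K, hK, hK', h⟩ := hσ.exists_eq_one
  obtain ⟨Φ, hΦ, hgen⟩ := exists_mul_zpow_mem_inertiaSubgroup S
  refine hirr.finite_range hdet ((inertiaSubgroup F Fbar).subgroupOf S) ?_ ⟨Φ, hΦ⟩
    fun w => hgen w w.2
  let I := (inertiaSubgroup F Fbar).subgroupOf S
  let N : Subgroup I := ((weilSubgroupOf Fbar K).subgroupOf S).subgroupOf I
  have h1 := Representation.finite_range_of_finiteIndex (σ.comp I.subtype) N
    fun x hx => h x hx x.2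
  refine h1.subset ?_
  rintro _ ⟨x, hx, rfl⟩
  exact ⟨⟨x, hx⟩, rfl⟩

end Smooth

/-! ### The isotropy group -/

section IsotropyGroup

variable {F Fbar : Type*} [Field F] [ValuativeRel F] [Field Fbar] [Algebra F Fbar]
  [IsGalois F Fbar] {k U : Type*} [Field k] [AddCommGroup U] [Module k U]

/-- If `α` is trivial on `P ∩ W_K` with `K / F` normal, then every `g` in `W_K` fixes `α`, because
the commutators of `g` with `P` are in `P ∩ W_K`. -/
theorem weilSubgroupOf_le_isotropyGroup {α : Representation k (wildInertia F Fbar) U}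
    (K : IntermediateField F Fbar) [Normal F K]
    (hK : ∀ x : wildInertia F Fbar, (x : WeilGroup F Fbar) ∈ weilSubgroupOf Fbar K → α x = 1) :
    weilSubgroupOf Fbar K ≤ isotropyGroup α := by
  intro g hg
  have : conjRep α g = α := by
    refine MonoidHom.ext fun x => ?_
    have h1 : α ((MulAut.conjNormal g : MulAut (wildInertia F Fbar)) x * x⁻¹) = 1 := by
      refine hK _ ?_
      have h2 := mul_mem hg (Subgroup.Normal.conj_mem inferInstance _ (inv_mem hg)
        (x : WeilGroup F Fbar))
      convert h2 using 1
      simp [mul_assoc]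
    have h3 := congrArg (fun f => f * α x) h1
    rw [one_mul, ← map_mul, inv_mul_cancel_right] at h3
    exact h3
  change Nonempty ((conjRep α g).Equiv α)
  rw [this]
  exact ⟨Representation.Equiv.refl _⟩

/-- If the isotropy group of `α` contains `W_K` for a finite extension `K / F`, then it is the Weil
group of its fixed field: the fixing subgroup of that field is the closure of the isotropy group in
the Galois group, and modulo the open subgroup of `K` the closure adds nothing. -/
theorem isotropyGroup_eq {α : Representation k (wildInertia F Fbar) U}
    (K : IntermediateField F Fbar) [FiniteDimensional F K]
    (hK : weilSubgroupOf Fbar K ≤ isotropyGroup α) :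
    weilSubgroupOf Fbar (isotropyField α) = isotropyGroup α := by
  refine le_antisymm (fun w hw => ?_) (isotropyGroup_le α)
  set J := (isotropyGroup α).map (WeilGroup.toGal F Fbar) with hJ
  let C : ClosedSubgroup (Fbar ≃ₐ[F] Fbar) := ⟨J.topologicalClosure, J.isClosed_topologicalClosure⟩
  have h1 : WeilGroup.toGal F Fbar w ∈ J.topologicalClosure := by
    have h2 := InfiniteGalois.fixingSubgroup_fixedField C
    have h3 : IntermediateField.fixedField C.toSubgroup ≤ isotropyField α :=
      fun x hx g => hx ⟨g, J.le_topologicalClosure g.2⟩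
    have h4 : WeilGroup.toGal F Fbar w ∈ (IntermediateField.fixedField
        C.toSubgroup).fixingSubgroup := IntermediateField.fixingSubgroup_antitone h3 hw
    rw [h2] at h4
    exact h4
  have h5 : {g | (WeilGroup.toGal F Fbar w)⁻¹ * g ∈ K.fixingSubgroup} ∈
      nhds (WeilGroup.toGal F Fbar w) :=
    (K.fixingSubgroup_isOpen.preimage (continuous_const_mul _)).mem_nhds (by simp [one_mem])
  obtain ⟨_, h6, g, hg, rfl⟩ := mem_closure_iff_nhds.1 h1 _ h5
  have h7 : w⁻¹ * g ∈ weilSubgroupOf Fbar K := by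
    rw [weilSubgroupOf, Subgroup.mem_comap, map_mul, map_inv]
    exact h6
  have h8 := mul_mem hg (inv_mem (hK h7))
  rwa [mul_inv_rev, inv_inv, mul_inv_cancel_left] at h8

end IsotropyGroup

/-! ### The congruence for the Weil group -/

/-- An irreducible representation that contains the trivial representation of a normal subgroup `P`
with finite positive multiplicity is trivial on `P` and finite-dimensional. -/
theorem IsIrreducibleSmoothOver.eq_one_and_finiteDimensional {k G V : Type*} [Field k] [Group G]
    [TopologicalSpace G] [AddCommGroup V] [Module k V] {P : Subgroup G} [P.Normal] {m : ℕ}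
    (hm : 1 ≤ m) {σ : Representation k G V}
    (h : IsIrreducibleSmoothOver (Representation.trivial k P k) m σ) :
    (∀ x ∈ P, σ x = 1) ∧ FiniteDimensional k V := by
  have hpos : 0 < Module.finrank k
      (Representation.IntertwiningMap (Representation.trivial k P k) (σ.comp P.subtype)) := by
    rw [h.multiplicity]
    exact hm
  have := Module.nontrivial_of_finrank_pos hpos
  obtain ⟨f, hf⟩ := exists_ne (0 : Representation.IntertwiningMap
    (Representation.trivial k P k) (σ.comp P.subtype))
  have hf1 : f.toLinearMap 1 ≠ 0 := by
    intro h0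
    refine hf (Representation.IntertwiningMap.ext (LinearMap.ext_ring ?_))
    rw [h0]
    rfl
  have h1 : ∀ x ∈ P, σ x = 1 := fun x hx => h.irreducible.eq_one_of_mem_normal P hf1
    (fun y hy => (LinearMap.congr_fun (f.isIntertwining' ⟨y, hy⟩) 1).symm) hx
  refine ⟨h1, ?_⟩
  have := Module.finite_of_finrank_pos hpos
  -- A vector `v` gives the intertwining map `c ↦ c • v`.
  let φ : V →ₗ[k] Representation.IntertwiningMap (Representation.trivial k P k)
      (σ.comp P.subtype) :=
    { toFun := fun v => ⟨LinearMap.toSpanSingleton k V v, fun x => by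
        rw [show (σ.comp P.subtype) x = 1 from h1 x x.2]
        rfl⟩
      map_add' := fun v w => Representation.IntertwiningMap.ext
        (LinearMap.toSpanSingleton_add v w)
      map_smul' := fun c v => Representation.IntertwiningMap.ext
        (LinearMap.toSpanSingleton_smul c v) }
  refine FiniteDimensional.of_injective φ fun v w hvw => ?_
  have := LinearMap.congr_fun (congrArg (fun f => f.toLinearMap) hvw) (1 : k)
  simpa [φ] using this

theorem mainTheorem8 {F Fbar : Type*} [Field F] [ValuativeRel F] [TopologicalSpace F]
    [IsNonarchimedeanLocalField F] [Field Fbar] [Algebra F Fbar] [IsSepClosure F Fbar]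
    (p ℓ : ℕ) [CharP 𝓀[F] p] [Fact ℓ.Prime] (hpℓ : p ≠ ℓ)
    {U : Type*} [AddCommGroup U] [Module (PadicAlgCl ℓ) U]
    (α : Representation (PadicAlgCl ℓ) (wildInertia F Fbar) U)
    (hα_irr : α.IsIrreducible) (hα_smooth : α.IsSmooth)
    {V : Type*} [AddCommGroup V] [Module (PadicAlgCl ℓ) V]
    (ρ : Representation (PadicAlgCl ℓ) (weilSubgroupOf Fbar (isotropyField α)) V)
    (hρ_smooth : ρ.IsSmooth) (hρ_ext : Nonempty ((resWild α ρ).Equiv α))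
    (hρ_det : ρ.DetFiniteOrder)
    (m : ℕ) (hm : 1 ≤ m)
    {T₁ : Type*} [AddCommGroup T₁] [Module (PadicAlgCl ℓ) T₁]
    {T₂ : Type*} [AddCommGroup T₂] [Module (PadicAlgCl ℓ) T₂]
    (τ₁ : Representation (PadicAlgCl ℓ) (weilSubgroupOf Fbar (isotropyField α)) T₁)
    (τ₂ : Representation (PadicAlgCl ℓ) (weilSubgroupOf Fbar (isotropyField α)) T₂)
    (hτ₁ : IsIrreducibleSmoothOver (Representation.trivial (PadicAlgCl ℓ)
      (wildInertiaOf Fbar (isotropyField α)) (PadicAlgCl ℓ)) m τ₁)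
    (hτ₂ : IsIrreducibleSmoothOver (Representation.trivial (PadicAlgCl ℓ)
      (wildInertiaOf Fbar (isotropyField α)) (PadicAlgCl ℓ)) m τ₂)
    (hτ₁_det : τ₁.DetFiniteOrder) (hτ₂_det : τ₂.DetFiniteOrder) :
    CongruentMod (indWeil (isotropyField α) (ρ.tprod τ₁))
        (indWeil (isotropyField α) (ρ.tprod τ₂)) ↔
      CongruentMod τ₁ τ₂ := by
  have : IsGalois F Fbar := {}
  have := finiteDimensional_of_isSmooth_wildInertia hα_irr hα_smooth
  obtain ⟨e⟩ := hρ_ext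
  have : FiniteDimensional (PadicAlgCl ℓ) V := e.toLinearEquiv.symm.finiteDimensional
  -- A finite Galois extension `K` such that `α` and `ρ` are trivial on `P_F ∩ W_K`.
  obtain ⟨K, hK, hK', hαK⟩ := hα_smooth.exists_eq_one
  have hαK' : ∀ x : wildInertia F Fbar, (x : WeilGroup F Fbar) ∈ weilSubgroupOf Fbar K →
      α x = 1 := fun x hx => hαK x hx (wildInertia_le_inertiaSubgroup x.2)
  have hKiso := weilSubgroupOf_le_isotropyGroup K hαK'
  have hiso := isotropyGroup_eq K hKiso
  have : (weilSubgroupOf Fbar (isotropyField α)).FiniteIndex :=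
    Subgroup.finiteIndex_of_le (hKiso.trans hiso.ge)
  have : (wildInertiaOf Fbar (isotropyField α)).Normal :=
    inferInstanceAs ((wildInertia F Fbar).subgroupOf _).Normal
  obtain ⟨hτ₁P, _⟩ := hτ₁.eq_one_and_finiteDimensional hm
  obtain ⟨hτ₂P, _⟩ := hτ₂.eq_one_and_finiteDimensional hm
  have hirr : (resWild α ρ).IsIrreducible := .of_equiv e hα_irr
  have hρ_irr : ρ.IsIrreducible := .of_restrict _ hirr
  have hcomm : ∀ x, e.toLinearEquiv ∘ₗ resWild α ρ x = α x ∘ₗ e.toLinearEquiv.toLinearMap :=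
    fun x => e.isIntertwining' x
  refine congruentMod_coind_tprod_iff (P := wildInertia F Fbar)
    (D := wildInertia F Fbar ⊓ weilSubgroupOf Fbar K) (wildInertia_le α) inf_le_left
    (fun x hx => ?_) ρ τ₁ τ₂ (hρ_smooth.finite_range hρ_irr hρ_det)
    (hτ₁.smooth.finite_range hτ₁.irreducible hτ₁_det)
    (hτ₂.smooth.finite_range hτ₂.irreducible hτ₂_det) (fun x => ?_)
    (fun x => hτ₁P _ x.2) (fun x => hτ₂P _ x.2) hirr fun g hg => ⟨fun f => hg ?_⟩
  · obtain ⟨n, hn, h⟩ := exists_coprime_pow_mem_weilSubgroupOf (Fact.out : ℓ.Prime) hpℓ K hx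
    exact ⟨n, hn, pow_mem hx n, h⟩
  · have h1 := hcomm ⟨x, x.2.1⟩
    rw [hαK' ⟨x, x.2.1⟩ x.2.2] at h1
    refine LinearMap.ext fun v => e.toLinearEquiv.injective ?_
    exact LinearMap.congr_fun h1 v
  · rw [hiso]
    -- Transport `f` along `e` to an isomorphism between the conjugate of `α` and `α`.
    let e' : (conjRep α g).Equiv ((resWild α ρ).comp
        (MulAut.conjNormal g : MulAut (wildInertia F Fbar)).toMonoidHom) :=
      ⟨⟨e.symm.toLinearMap, fun x => e.symm.isIntertwining' _⟩, e.symm.invFun, e.symm.left_inv,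
        e.symm.right_inv⟩
    exact ⟨(e'.trans f).trans e⟩

end
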